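/- Consider the $2\pi$-periodic Riccati equation $$u' = (\sin t-2)u^2+\eta-\cos t,\qquad \eta\in\mathbb R. \tag{1}$$ Throughout, $T=2\pi$ and "periodic" means $T$-periodic. Put $A(t)=\frac{\cos t}{2(\sin t-2)}$ and $$\gamma_\eta(t)=(\sin t-2)(\eta-\cos t)-A(t)^2+A'(t),$$ so that $x=(\sin t-2)u+A(t)$ transforms (1) into $x'=x^2+\gamma_\eta(t)$. Let $\overline\gamma_\eta=\frac1T\int_0^T\gamma_\eta(t)\,dt$ and $\widehat\gamma_\eta=\gamma_\eta-\overline\gamma_\eta$. For periodic $C^1$ functions $p$ and $q$, where $q$ has zero average, let $$\underline\mu_\eta(p)=-\max_{t\in[0,T]}\{p(t)^2+\widehat\gamma_\eta(t)-p'(t)\},\qquad \overline\mu_\eta(q)=\frac{\int_0^T e^{-2\int_0^t q(s)\,ds}\,(q(t)^2-\widehat\gamma_\eta(t))\,dt}{\int_0^T e^{-2\int_0^t q(s)\,ds}\,dt}.$$ A periodic solution of (1) is called hyperbolic (respectively double) if its value at $t=0$ is a zero of multiplicity one (respectively two) of the displacement map of (1), that is, of the Poincaré map at time $T$ minus the identity.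 Theorem. For every $\eta\in\mathbb R$ the maximum of $\underline\mu_\eta(p)$ over all periodic $C^1$ functions $p$ and the minimum of $\overline\mu_\eta(q)$ over all periodic $C^1$ functions $q$ with zero average exist and are equal. Denote the common value by $\mu^*(\eta)$, and define the discriminant $\Delta(\eta)=\mu^*(\eta)-\overline\gamma_\eta$. Then $\Delta$ has exactly one zero $\eta^*$ in $\mathbb R$, and $\eta^*\in\left(\frac{3-2\sqrt3}{24},1\right)$. Moreover $\Delta(\eta)<0$ for $\eta<\eta^*$ and $\Delta(\eta)>0$ for $\eta>\eta^*$. Equation (1) has no periodic solutions if $\eta<\eta^*$; it has exactly one periodic solution if $\eta=\eta^*$, and this solution is double; and it has exactly two periodic solutions if $\eta>\eta^*$, and both are hyperbolic. -/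

import Mathlib

noncomputable section

namespace Riccati

open Set Filter Topology

/-! ### Scalar `T`-periodic differential equations `x' = f (t, x)` -/

/-- `φ` is a (globally defined) `T`-periodic solution of `x' = f (t, x)`. -/
def IsPeriodicSolution (f : ℝ → ℝ → ℝ) (T : ℝ) (φ : ℝ → ℝ) : Prop :=
  (∀ t, HasDerivAt φ (f t (φ t)) t) ∧ Function.Periodic φ T

/-- `ψ` solves `x' = f (t, x)`, `x(0) = x₀` on the whole interval `[0, T]`. -/
def IsSolutionFrom (f : ℝ → ℝ → ℝ) (T x₀ : ℝ) (ψ : ℝ → ℝ) : Prop :=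
  ψ 0 = x₀ ∧ ∀ t ∈ Icc 0 T, HasDerivWithinAt ψ (f t (ψ t)) (Icc 0 T) t

open Classical in
/-- The displacement map `x₀ ↦ ψ(T) - x₀` (Poincaré map at time `T` minus the identity), where `ψ`
is the solution with `ψ(0) = x₀`, which is unique on `[0, T]` when `f` is continuous, and locally
Lipschitz in `x`. It has the value `0` by convention at the points `x₀` whose solution does not
reach time `T`; `HasMultiplicity` below only looks at it on open sets without such points. -/
def displacement (f : ℝ → ℝ → ℝ) (T : ℝ) (x₀ : ℝ) : ℝ :=
  if h : ∃ ψ, IsSolutionFrom f T x₀ ψ then h.choose T - x₀ else 0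

/-- The periodic solution `φ` has multiplicity `n`: the displacement map is defined in a
neighbourhood of `φ(0)`, and `φ(0)` is a zero of multiplicity `n` of it. -/
def HasMultiplicity (f : ℝ → ℝ → ℝ) (T : ℝ) (φ : ℝ → ℝ) (n : ℕ) : Prop :=
  (∀ᶠ x₀ in 𝓝 (φ 0), ∃ ψ, IsSolutionFrom f T x₀ ψ) ∧
  ContDiffAt ℝ n (displacement f T) (φ 0) ∧
  (∀ k < n, iteratedDeriv k (displacement f T) (φ 0) = 0) ∧
  iteratedDeriv n (displacement f T) (φ 0) ≠ 0

/-- A periodic solution is hyperbolic if it is a simple zero of the displacement map. -/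
def IsHyperbolic (f : ℝ → ℝ → ℝ) (T : ℝ) (φ : ℝ → ℝ) : Prop :=
  HasMultiplicity f T φ 1

/-- A periodic solution is double if it is a zero of multiplicity two of the displacement map. -/
def IsDouble (f : ℝ → ℝ → ℝ) (T : ℝ) (φ : ℝ → ℝ) : Prop :=
  HasMultiplicity f T φ 2

/-! ### The discriminant of `x' = x ^ 2 + γ (t)` -/

/-- The average of a `T`-periodic function. -/
def average (T : ℝ) (γ : ℝ → ℝ) : ℝ :=
  (1 / T) * ∫ t in (0 : ℝ)..T, γ t

/-- The mean-centered function `γ - average γ`. -/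
def centered (T : ℝ) (γ : ℝ → ℝ) (t : ℝ) : ℝ :=
  γ t - average T γ

/-- The space of `T`-periodic `C¹` functions. -/
def periodicC1 (T : ℝ) : Set (ℝ → ℝ) :=
  {p | ContDiff ℝ 1 p ∧ Function.Periodic p T}

/-- The space of `T`-periodic `C¹` functions with zero average. -/
def periodicC1Zero (T : ℝ) : Set (ℝ → ℝ) :=
  {p | p ∈ periodicC1 T ∧ average T p = 0}

/-- The functional `p ↦ - max_{[0, T]} (p ^ 2 + centered γ - p')`. -/
def lowerMu (T : ℝ) (γ p : ℝ → ℝ) : ℝ :=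
  - sSup ((fun t => p t ^ 2 + centered T γ t - deriv p t) '' Icc 0 T)

/-- The weight `exp (- 2 ∫₀ᵗ p)`. -/
def weight (p : ℝ → ℝ) (t : ℝ) : ℝ :=
  Real.exp (-2 * ∫ s in (0 : ℝ)..t, p s)

/-- The functional sending `p` to the mean value of `p ^ 2 - centered γ` on `[0, T]` with respect
to the weight `exp (- 2 ∫₀ᵗ p)`. -/
def upperMu (T : ℝ) (γ p : ℝ → ℝ) : ℝ :=
  (∫ t in (0 : ℝ)..T, weight p t)⁻¹ *
    ∫ t in (0 : ℝ)..T, weight p t * (p t ^ 2 - centered T γ t)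

/-- The number `γ*`, the maximum of `lowerMu` over the `T`-periodic `C¹` functions. -/
def gammaStar (T : ℝ) (γ : ℝ → ℝ) : ℝ :=
  sSup (lowerMu T γ '' periodicC1 T)

/-- The discriminant of `x' = x ^ 2 + γ (t)`. -/
def discriminant (T : ℝ) (γ : ℝ → ℝ) : ℝ :=
  gammaStar T γ - average T γ

/-! ### Reduction of `x' = a₂ x ^ 2 + a₁ x + a₀` to the form `y' = y ^ 2 + γ` -/

/-- The function `A = (a₁ + a₂' / a₂) / 2`; the reduction is `y = a₂ x + A`. -/
def shift (a₂ a₁ : ℝ → ℝ) (t : ℝ) : ℝ :=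
  (1 / 2) * (a₁ t + deriv a₂ t / a₂ t)

/-- The function `γ = a₂ a₀ - A ^ 2 + A'`. -/
def reducedGamma (a₂ a₁ a₀ : ℝ → ℝ) (t : ℝ) : ℝ :=
  a₂ t * a₀ t - shift a₂ a₁ t ^ 2 + deriv (shift a₂ a₁) t

/-! ### The family `u' = (sin t - 2) u ^ 2 + η - cos t` -/

/-- The right-hand side of the family. -/
def familyField (η : ℝ) (t u : ℝ) : ℝ :=
  (Real.sin t - 2) * u ^ 2 + η - Real.cos t

/-- The function `γ` of the family, for `a₂ = sin t - 2`, `a₁ = 0`, `a₀ = η - cos t`. -/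
def familyGamma (η : ℝ) : ℝ → ℝ :=
  reducedGamma (fun t => Real.sin t - 2) (fun _ => 0) (fun t => η - Real.cos t)

/-- The discriminant of the family, as a function of `η`. -/
def familyDiscriminant (η : ℝ) : ℝ :=
  discriminant (2 * Real.pi) (familyGamma η)

end Riccati

end

/-!
Call `m` a level of `γ` if `x' = x ^ 2 + γ (t) + m` has a periodic upper solution `p`, that is
`p' ≥ p ^ 2 + γ + m`. For smaller `m` such a `p` is strict, and trajectories starting at `p 0` end
below it; since the field is positive for large `|x|`, the Poincaré map has a fixed point on either
side of `p 0`. Let `D` be the supremum of the levels. A limit of periodic solutions shows that the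
equation at level `D` has a periodic solution `φ`, and `φ` has zero mean, since otherwise
`d' = 2 φ d + 1` has a periodic solution `d` and `φ + ε d` has a level above `D`. Conversely, for
zero-mean `φ` the identity
`(w (p - φ))' = w (p' - p ^ 2 - γ - D + (p - φ) ^ 2)` with `w = exp (-2 ∫ φ)` periodic shows that
`D` is the largest level, so `D + average γ` is the maximum of `lowerMu`; completing the square in
`∫ (exp (-2 ∫ q) φ)' = 0` shows that it is also the minimum of `upperMu`, attained at `q = φ`.
Hence `D` is the discriminant.

The same identity shows that a zero-mean periodic solution is the only one. Two distinct periodic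
solutions have opposite means, which excludes a third one when the discriminant is positive. Near a
periodic solution the displacement map is that of a Möbius map whose multiplier is determined by
the mean of the solution, so nonzero mean means hyperbolic, and zero mean means double.

For the family, `∂γ/∂η = sin t - 2` lies between `-3` and `-1`, which makes the discriminant
continuous and strictly increasing in `η`. At the left end `average γ = 0`, and `γ* < 0` because `γ`
is not constant; at `η = 1` an explicit strict upper solution makes the discriminant positive.
-/

noncomputable section

namespace Riccati

open Set Filter Topology
open scoped NNReal

/-! ### Periodic functions -/

section Periodic

variable {T : ℝ} {p q : ℝ → ℝ}

lemma exists_forall_le_of_periodic (hT : 0 < T) (hc : Continuous p)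
    (hp : Function.Periodic p T) : ∃ s, ∀ t, p t ≤ p s := by
  obtain ⟨_, ⟨s, rfl⟩, hs⟩ :=
    (hp.compact_of_continuous hT.ne' hc).exists_isGreatest (range_nonempty p)
  exact ⟨s, fun t => hs (mem_range_self t)⟩

lemma exists_abs_le_of_periodic (hT : 0 < T) (hc : Continuous p)
    (hp : Function.Periodic p T) : ∃ K, ∀ t, |p t| ≤ K :=
  (exists_forall_le_of_periodic hT hc.abs (hp.comp abs)).imp' _ fun _ => id

lemma eq_of_periodic_of_eqOn_Icc (hT : 0 < T) (hp : Function.Periodic p T)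
    (hq : Function.Periodic q T) (h : EqOn p q (Icc 0 T)) : p = q := by
  funext t
  obtain ⟨s, hs, hst⟩ := (hp.sub hq).exists_mem_Ico₀ hT t
  rw [Pi.sub_apply, Pi.sub_apply, h (Ico_subset_Icc_self hs), sub_self] at hst
  exact sub_eq_zero.1 hst

lemma periodic_deriv (h : Function.Periodic p T) : Function.Periodic (deriv p) T := fun t => by
  rw [← deriv_comp_add_const, show (fun s => p (s + T)) = p from funext h]

lemma mem_periodicC1_of_hasDerivAt {p' : ℝ → ℝ} (h : ∀ t, HasDerivAt p (p' t) t)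
    (hc : Continuous p') (hp : Function.Periodic p T) : p ∈ periodicC1 T := by
  refine ⟨contDiff_one_iff_deriv.2 ⟨fun t => (h t).differentiableAt, ?_⟩, hp⟩
  rwa [show deriv p = p' from funext fun t => (h t).deriv]

lemma hasDerivAt_of_mem_periodicC1 (h : p ∈ periodicC1 T) (t : ℝ) :
    HasDerivAt p (deriv p t) t :=
  (h.1.differentiable one_ne_zero t).hasDerivAt

lemma continuous_deriv_of_mem_periodicC1 (h : p ∈ periodicC1 T) : Continuous (deriv p) :=
  h.1.continuous_deriv le_rfl

lemma integral_add_const (hp : Continuous p) (c : ℝ) :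
    ∫ t in (0 : ℝ)..T, (p t + c) = (∫ t in (0 : ℝ)..T, p t) + T * c := by
  rw [intervalIntegral.integral_add (hp.intervalIntegrable _ _) intervalIntegrable_const,
    intervalIntegral.integral_const, sub_zero, smul_eq_mul]

lemma integral_ne_zero_of_forall_ne_zero (hT : 0 < T) (hc : Continuous p) (h : ∀ t, p t ≠ 0) :
    ∫ t in (0 : ℝ)..T, p t ≠ 0 := by
  intro h0
  obtain ⟨t, -, ht⟩ := exists_hasDerivAt_eq_zero (f := fun t => ∫ s in (0 : ℝ)..t, p s) hT
    (fun t _ => (hc.integral_hasStrictDerivAt 0 t).hasDerivAt.continuousAt.continuousWithinAt)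
    (by simp [h0]) fun t _ => (hc.integral_hasStrictDerivAt 0 t).hasDerivAt
  exact h t ht

end Periodic

/-! ### Scalar equations -/

section ScalarEquation

variable {f g : ℝ → ℝ → ℝ} {T c R : ℝ} {K : ℝ≥0} {ψ p : ℝ → ℝ}

lemma IsSolutionFrom.continuousOn (h : IsSolutionFrom f T c ψ) : ContinuousOn ψ (Icc 0 T) :=
  fun t ht => (h.2 t ht).continuousWithinAt

lemma IsSolutionFrom.hasDerivWithinAt_Ici (h : IsSolutionFrom f T c ψ) :
    ∀ t ∈ Ico 0 T, HasDerivWithinAt ψ (f t (ψ t)) (Ici t) t := fun t ht =>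
  (h.2 t (Ico_subset_Icc_self ht)).mono_of_mem_nhdsWithin (Icc_mem_nhdsGE_of_mem ht)

lemma exists_isSolutionFrom {L : ℝ} (hT : 0 ≤ T) (hcont : ∀ x, Continuous fun t => f t x)
    (hbound : ∀ t ∈ Icc 0 T, ∀ x, |f t x| ≤ L) (hlip : ∀ t, LipschitzWith K (f t)) (c : ℝ) :
    ∃ ψ, IsSolutionFrom f T c ψ := by
  have hL : 0 ≤ L := (abs_nonneg _).trans (hbound 0 ⟨le_rfl, hT⟩ 0)
  have hPicard : IsPicardLindelof f (tmin := 0) (tmax := T) ⟨0, le_rfl, hT⟩ c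
      (Real.toNNReal (L * T)) 0 (Real.toNNReal L) K :=
    { lipschitzOnWith := fun t _ => (hlip t).lipschitzOnWith
      continuousOn := fun x _ => (hcont x).continuousOn
      norm_le := fun t ht x _ => (hbound t ht x).trans (Real.le_coe_toNNReal L)
      mul_max_le := by
        rw [Real.coe_toNNReal _ hL, Real.coe_toNNReal _ (by positivity)]
        simp [hT] }
  exact hPicard.exists_eq_forall_mem_Icc_hasDerivWithinAt₀

lemma abs_sub_le_gronwallBound {c₁ c₂ ε : ℝ} {ψ₁ ψ₂ : ℝ → ℝ} (hT : 0 ≤ T)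
    (hlip : ∀ t, LipschitzWith K (f t)) (hfg : ∀ t x, |g t x - f t x| ≤ ε)
    (h₁ : IsSolutionFrom g T c₁ ψ₁) (h₂ : IsSolutionFrom f T c₂ ψ₂) :
    |ψ₁ T - ψ₂ T| ≤ gronwallBound |c₁ - c₂| K ε T := by
  have h := dist_le_of_approx_trajectories_ODE (εf := ε) (εg := 0) (δ := |c₁ - c₂|) hlip
    h₁.continuousOn h₁.hasDerivWithinAt_Ici (fun t _ => hfg t (ψ₁ t))
    h₂.continuousOn h₂.hasDerivWithinAt_Ici (fun t _ => (dist_self _).le)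
    (by rw [h₁.1, h₂.1, Real.dist_eq]) T ⟨hT, le_rfl⟩
  simpa only [Real.dist_eq, add_zero, sub_zero] using h

lemma gronwallBound_eq_mul_add_mul (δ L ε x : ℝ) :
    gronwallBound δ L ε x = δ * Real.exp (L * x) + ε * gronwallBound 0 L 1 x := by
  by_cases hL : L = 0
  · simp [hL, gronwallBound_K0]
  · simp only [gronwallBound_of_K_ne_0 hL]
    ring

lemma IsSolutionFrom.le_of_deriv_gt (hψ : IsSolutionFrom f T c ψ) (hp : Differentiable ℝ p)
    (hupper : ∀ t, f t (p t) < deriv p t) (h0 : c ≤ p 0) : ∀ t ∈ Icc 0 T, ψ t ≤ p t :=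
  image_le_of_deriv_right_lt_deriv_boundary hψ.continuousOn hψ.hasDerivWithinAt_Ici
    (hψ.1.trans_le h0) (fun t => (hp t).hasDerivAt) fun t _ h => h ▸ hupper t

lemma IsSolutionFrom.ge_of_deriv_lt (hψ : IsSolutionFrom f T c ψ) (hp : Differentiable ℝ p)
    (hlower : ∀ t, deriv p t < f t (p t)) (h0 : p 0 ≤ c) : ∀ t ∈ Icc 0 T, p t ≤ ψ t :=
  image_le_of_deriv_right_lt_deriv_boundary' hp.continuous.continuousOn
    (fun t _ => (hp t).hasDerivAt.hasDerivWithinAt) (h0.trans_eq hψ.1.symm) hψ.continuousOn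
    hψ.hasDerivWithinAt_Ici fun t _ h => h ▸ hlower t

lemma exists_fixedPoint_le_and_ge (hT : 0 ≤ T) (hex : ∀ c, ∃ ψ, IsSolutionFrom f T c ψ)
    (hlip : ∀ t, LipschitzWith K (f t)) (hpos : ∀ t x, R ≤ |x| → 0 < f t x)
    (hc : ∀ ψ, IsSolutionFrom f T c ψ → ψ T ≤ c) :
    (∃ c₁ ≤ c, ∃ ψ, IsSolutionFrom f T c₁ ψ ∧ ψ T = c₁) ∧
      ∃ c₂ ≥ c, ∃ ψ, IsSolutionFrom f T c₂ ψ ∧ ψ T = c₂ := by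
  choose Ψ hΨ using hex
  have hcont : Continuous fun d => Ψ d T - d := by
    refine Continuous.sub ?_ continuous_id
    refine (LipschitzWith.of_dist_le_mul (K := Real.toNNReal (Real.exp (K * T)))
      fun d₁ d₂ => ?_).continuous
    have h := abs_sub_le_gronwallBound (ε := 0) hT hlip (by simp) (hΨ d₁) (hΨ d₂)
    rwa [Real.coe_toNNReal _ (Real.exp_pos _).le, mul_comm, ← gronwallBound_ε0]
  have hlarge : ∀ d, R ≤ |d| → 0 ≤ Ψ d T - d := fun d hd =>
    sub_nonneg.2 ((hΨ d).ge_of_deriv_lt (differentiable_const d)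
      (fun t => by rw [deriv_const]; exact hpos t d hd) le_rfl T ⟨hT, le_rfl⟩)
  have hsmall : Ψ c T - c ≤ 0 := sub_nonpos.2 (hc _ (hΨ c))
  set M := max R |c|
  have hRM : R ≤ |M| := (le_max_left _ _).trans (le_abs_self _)
  have hcM : |c| ≤ M := le_max_right _ _
  constructor
  · obtain ⟨d, hd, hd0⟩ := intermediate_value_Icc' (neg_le_of_abs_le hcM) hcont.continuousOn
      ⟨hsmall, hlarge (-M) (by rwa [abs_neg])⟩
    exact ⟨d, hd.2, Ψ d, hΨ d, sub_eq_zero.1 hd0⟩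
  · obtain ⟨d, hd, hd0⟩ := intermediate_value_Icc (le_of_abs_le hcM) hcont.continuousOn
      ⟨hsmall, hlarge M hRM⟩
    exact ⟨d, hd.1, Ψ d, hΨ d, sub_eq_zero.1 hd0⟩

lemma exists_fixedPoint_of_tendsto {F : ℕ → ℝ → ℝ → ℝ} {Ψ : ℕ → ℝ → ℝ} {c ε : ℕ → ℝ} (hT : 0 ≤ T)
    (hex : ∀ c, ∃ ψ, IsSolutionFrom f T c ψ) (hlip : ∀ t, LipschitzWith K (f t))
    (hF : ∀ n t x, |F n t x - f t x| ≤ ε n) (hε : Tendsto ε atTop (𝓝 0))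
    (hΨ : ∀ n, IsSolutionFrom (F n) T (c n) (Ψ n)) (hΨT : ∀ n, Ψ n T = c n)
    (hc : ∀ n, |c n| ≤ R) : ∃ c, ∃ ψ, IsSolutionFrom f T c ψ ∧ ψ T = c := by
  obtain ⟨c', -, s, hs, hlim⟩ :=
    isCompact_Icc.tendsto_subseq (x := c) fun n => abs_le.1 (hc n)
  obtain ⟨ψ, hψ⟩ := hex c'
  refine ⟨c', ψ, hψ, ?_⟩
  have hbound : ∀ n, |c (s n) - ψ T| ≤
      |c (s n) - c'| * Real.exp (K * T) + ε (s n) * gronwallBound 0 K 1 T := fun n => by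
    rw [← gronwallBound_eq_mul_add_mul]
    nth_rewrite 1 [← hΨT]
    exact abs_sub_le_gronwallBound hT hlip (hF _) (hΨ _) hψ
  have hzero : Tendsto (fun n => |c (s n) - c'| * Real.exp (K * T) +
      ε (s n) * gronwallBound 0 K 1 T) atTop (𝓝 0) := by
    have h := ((hlim.sub_const c').abs.mul_const (Real.exp (K * T))).add
      ((hε.comp hs.tendsto_atTop).mul_const (gronwallBound 0 K 1 T))
    simpa using h
  have habs : |c' - ψ T| ≤ 0 := le_of_tendsto_of_tendsto' (hlim.sub_const _).abs hzero hbound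
  exact (sub_eq_zero.1 (abs_nonpos_iff.1 habs)).symm

end ScalarEquation

section PeriodicSolution

variable {f g : ℝ → ℝ → ℝ} {T c R : ℝ} {K : ℝ≥0} {φ ψ p : ℝ → ℝ}

lemma IsPeriodicSolution.continuous (h : IsPeriodicSolution f T φ) : Continuous φ :=
  continuous_iff_continuousAt.2 fun t => (h.1 t).continuousAt

lemma IsPeriodicSolution.isSolutionFrom (h : IsPeriodicSolution f T φ) :
    IsSolutionFrom f T (φ 0) φ :=
  ⟨rfl, fun t _ => (h.1 t).hasDerivWithinAt⟩

lemma IsPeriodicSolution.congr (h : IsPeriodicSolution f T φ)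
    (hfg : ∀ t, f t (φ t) = g t (φ t)) : IsPeriodicSolution g T φ :=
  ⟨fun t => hfg t ▸ h.1 t, h.2⟩

lemma IsPeriodicSolution.mem_periodicC1 (h : IsPeriodicSolution f T φ)
    (hf : Continuous (Function.uncurry f)) : φ ∈ periodicC1 T :=
  mem_periodicC1_of_hasDerivAt h.1 (hf.comp (continuous_id.prodMk h.continuous)) h.2

lemma exists_continuous_periodic_eqOn_Icc (hT : 0 < T) (hc : ContinuousOn ψ (Icc 0 T))
    (h : ψ 0 = ψ T) : ∃ y, Continuous y ∧ Function.Periodic y T ∧ EqOn y ψ (Icc 0 T) := by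
  have : Fact (0 < T) := ⟨hT⟩
  refine ⟨fun t => AddCircle.liftIco T 0 ψ (t : AddCircle T),
    (AddCircle.liftIco_zero_continuous h hc).comp (AddCircle.continuous_mk' T),
    fun t => by simp, fun t ht => ?_⟩
  rcases ht.2.lt_or_eq with hlt | rfl
  · exact AddCircle.liftIco_zero_coe_apply ⟨ht.1, hlt⟩
  · dsimp only
    rw [AddCircle.coe_period, ← h]
    exact AddCircle.liftIco_zero_coe_apply ⟨le_rfl, hT⟩

lemma isPeriodicSolution_of_isSolutionFrom (hT : 0 < T) (hf : Continuous (Function.uncurry f))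
    (hper : ∀ t x, f (t + T) x = f t x) (hc : Continuous φ) (hp : Function.Periodic φ T)
    (h : IsSolutionFrom f T c φ) : IsPeriodicSolution f T φ := by
  set Y : ℝ → ℝ := fun t => c + ∫ s in (0 : ℝ)..t, f s (φ s)
  have hgc : Continuous fun s => f s (φ s) := hf.comp (continuous_id.prodMk hc)
  have hgp : Function.Periodic (fun s => f s (φ s)) T := fun t => by simp only [hp t, hper]
  have hY : ∀ t, HasDerivAt Y (f t (φ t)) t := fun t =>
    (hgc.integral_hasStrictDerivAt 0 t).hasDerivAt.const_add c
  have hYφ : EqOn Y φ (Icc 0 T) := fun t ht => by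
    have hFTC := intervalIntegral.integral_eq_sub_of_hasDeriv_right_of_le ht.1 hc.continuousOn
      (fun s hs => (h.hasDerivWithinAt_Ici s ⟨hs.1.le, hs.2.trans_le ht.2⟩).mono
        Ioi_subset_Ici_self) (hgc.intervalIntegrable _ _)
    simp only [Y, hFTC, h.1, add_sub_cancel]
  have hI : ∫ s in (0 : ℝ)..T, f s (φ s) = 0 := by
    have hYT : Y T = c := by rw [hYφ ⟨hT.le, le_rfl⟩, ← zero_add T, hp 0, h.1]
    simpa [Y] using hYT
  have hYp : Function.Periodic Y T := fun t => by
    have hadd := hgp.intervalIntegral_add_eq_add 0 t fun _ _ => hgc.intervalIntegrable _ _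
    rw [zero_add, hI, add_zero] at hadd
    simp only [Y, hadd]
  exact ⟨eq_of_periodic_of_eqOn_Icc hT hYp hp hYφ ▸ hY, hp⟩

lemma exists_isPeriodicSolution_of_fixedPoint (hT : 0 < T)
    (hf : Continuous (Function.uncurry f)) (hper : ∀ t x, f (t + T) x = f t x)
    (hψ : IsSolutionFrom f T c ψ) (hψT : ψ T = c) :
    ∃ φ, IsPeriodicSolution f T φ ∧ φ 0 = c := by
  obtain ⟨φ, hc, hp, hφψ⟩ :=
    exists_continuous_periodic_eqOn_Icc hT hψ.continuousOn (by rw [hψ.1, hψT])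
  have hφ0 : φ 0 = c := by rw [hφψ ⟨le_rfl, hT.le⟩, hψ.1]
  refine ⟨φ, isPeriodicSolution_of_isSolutionFrom (c := c) hT hf hper hc hp ⟨hφ0, fun t ht => ?_⟩,
    hφ0⟩
  rw [hφψ ht]
  exact (hψ.2 t ht).congr hφψ (hφψ ht)

lemma IsPeriodicSolution.abs_apply_lt (hT : 0 < T) (h : IsPeriodicSolution f T φ)
    (hne : ∀ t x, R ≤ |x| → f t x ≠ 0) (t : ℝ) : |φ t| < R := by
  obtain ⟨t₁, h₁⟩ := exists_forall_le_of_periodic hT h.continuous h.2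
  obtain ⟨t₂, h₂⟩ := exists_forall_le_of_periodic hT h.continuous.neg (h.2.comp (fun x => -x))
  have hcrit : ∀ s, f s (φ s) = 0 → |φ s| < R := fun s hs =>
    not_le.1 fun hR => hne s _ hR hs
  have hmax := hcrit t₁ (IsLocalMax.hasDerivAt_eq_zero (Eventually.of_forall h₁) (h.1 t₁))
  have hmin := hcrit t₂ (IsLocalMin.hasDerivAt_eq_zero
    (Eventually.of_forall fun t => neg_le_neg_iff.1 (h₂ t)) (h.1 t₂))
  exact abs_lt.2 ⟨(abs_lt.1 hmin).1.trans_le (neg_le_neg_iff.1 (h₂ t)),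
    (h₁ t).trans_lt (abs_lt.1 hmax).2⟩

-- A solution starting at `p 0` stays below `p`, so `p - φ` would have a critical minimum at `0`.
lemma IsPeriodicSolution.ne_of_deriv_gt (hT : 0 < T) (h : IsPeriodicSolution f T φ)
    (hp : Differentiable ℝ p) (hpT : Function.Periodic p T)
    (hupper : ∀ t, f t (p t) < deriv p t) : φ 0 ≠ p 0 := by
  intro h0
  have hle : ∀ t, p 0 - φ 0 ≤ p t - φ t := fun t => by
    obtain ⟨s, hs, hst⟩ := (hpT.sub h.2).exists_mem_Ico₀ hT t
    rw [Pi.sub_apply, Pi.sub_apply] at hst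
    rw [hst, h0, sub_self]
    exact sub_nonneg.2
      (h.isSolutionFrom.le_of_deriv_gt hp hupper h0.le s (Ico_subset_Icc_self hs))
  have hcrit : deriv p 0 - f 0 (φ 0) = 0 :=
    IsLocalMin.hasDerivAt_eq_zero (Eventually.of_forall hle) ((hp 0).hasDerivAt.sub (h.1 0))
  have hlt := hupper 0
  rw [← h0] at hlt
  linarith

theorem exists_two_isPeriodicSolution_of_deriv_gt (hT : 0 < T)
    (hf : Continuous (Function.uncurry f)) (hper : ∀ t x, f (t + T) x = f t x)
    (hex : ∀ c, ∃ ψ, IsSolutionFrom f T c ψ) (hlip : ∀ t, LipschitzWith K (f t))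
    (hpos : ∀ t x, R ≤ |x| → 0 < f t x) (hp : Differentiable ℝ p)
    (hpT : Function.Periodic p T) (hupper : ∀ t, f t (p t) < deriv p t) :
    ∃ φ₁ φ₂, IsPeriodicSolution f T φ₁ ∧ IsPeriodicSolution f T φ₂ ∧
      φ₁ 0 < p 0 ∧ p 0 < φ₂ 0 := by
  have hdecr : ∀ ψ, IsSolutionFrom f T (p 0) ψ → ψ T ≤ p 0 := fun ψ hψ => by
    rw [← hpT 0, zero_add]
    exact hψ.le_of_deriv_gt hp hupper le_rfl T ⟨hT.le, le_rfl⟩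
  obtain ⟨⟨c₁, hc₁, ψ₁, hψ₁, hT₁⟩, c₂, hc₂, ψ₂, hψ₂, hT₂⟩ :=
    exists_fixedPoint_le_and_ge hT.le hex hlip hpos hdecr
  obtain ⟨φ₁, hφ₁, rfl⟩ := exists_isPeriodicSolution_of_fixedPoint hT hf hper hψ₁ hT₁
  obtain ⟨φ₂, hφ₂, rfl⟩ := exists_isPeriodicSolution_of_fixedPoint hT hf hper hψ₂ hT₂
  exact ⟨φ₁, φ₂, hφ₁, hφ₂, hc₁.lt_of_ne (hφ₁.ne_of_deriv_gt hT hp hpT hupper),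
    hc₂.lt_of_ne' (hφ₂.ne_of_deriv_gt hT hp hpT hupper)⟩

end PeriodicSolution

/-! ### The normal form `x' = x ^ 2 + γ (t)` -/

/-- The right-hand side of the normal form `x' = x ^ 2 + γ (t)` of a Riccati equation. -/
def normalField (γ : ℝ → ℝ) (t x : ℝ) : ℝ :=
  x ^ 2 + γ t

/-- The field `normalField γ` with `x` replaced by `min |x| R` in the square: a bounded, globally
Lipschitz field which agrees with `normalField γ` on `|x| ≤ R`, used for existence on `[0, T]`. -/
def truncField (R : ℝ) (γ : ℝ → ℝ) (t x : ℝ) : ℝ :=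
  min |x| R ^ 2 + γ t

section Truncation

variable {T R : ℝ} {γ φ p : ℝ → ℝ}

lemma continuous_uncurry_normalField (hγ : Continuous γ) :
    Continuous (Function.uncurry (normalField γ)) := by
  unfold Function.uncurry normalField
  fun_prop

lemma continuous_uncurry_truncField (hγ : Continuous γ) (R : ℝ) :
    Continuous (Function.uncurry (truncField R γ)) := by
  unfold Function.uncurry truncField
  fun_prop

lemma truncField_add_period (hγ : Function.Periodic γ T) (R t x : ℝ) :
    truncField R γ (t + T) x = truncField R γ t x := by
  rw [truncField, hγ t, truncField]

lemma truncField_eq_normalField {x : ℝ} (hx : |x| ≤ R) (γ : ℝ → ℝ) (t : ℝ) :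
    truncField R γ t x = normalField γ t x := by
  rw [truncField, normalField, min_eq_left hx, sq_abs]

lemma truncField_le_normalField (hR : 0 ≤ R) (γ : ℝ → ℝ) (t x : ℝ) :
    truncField R γ t x ≤ normalField γ t x := by
  rw [truncField, normalField, ← sq_abs x]
  gcongr
  exact min_le_left _ _

lemma truncField_pos (hγ : ∀ t, -γ t < R ^ 2) (t x : ℝ) (hx : R ≤ |x|) :
    0 < truncField R γ t x := by
  rw [truncField, min_eq_right hx]
  linarith [hγ t]

lemma normalField_pos (hR : 0 ≤ R) (hγ : ∀ t, -γ t < R ^ 2) (t x : ℝ) (hx : R ≤ |x|) :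
    0 < normalField γ t x :=
  (truncField_pos hγ t x hx).trans_le (truncField_le_normalField hR γ t x)

lemma lipschitzWith_truncField (hR : 0 ≤ R) (γ : ℝ → ℝ) (t : ℝ) :
    LipschitzWith (Real.toNNReal (2 * R)) (truncField R γ t) := by
  refine LipschitzWith.of_dist_le_mul fun x y => ?_
  rw [Real.coe_toNNReal _ (by positivity), Real.dist_eq, Real.dist_eq]
  have hsub : |min |x| R - min |y| R| ≤ |x - y| :=
    (abs_min_sub_min_le_max _ _ _ _).trans (by simpa using abs_abs_sub_abs_le x y)
  have hadd : |min |x| R + min |y| R| ≤ 2 * R := by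
    rw [abs_of_nonneg (by positivity)]
    linarith [min_le_right |x| R, min_le_right |y| R]
  calc |truncField R γ t x - truncField R γ t y|
      = |min |x| R + min |y| R| * |min |x| R - min |y| R| := by
        rw [← abs_mul, truncField, truncField]
        ring_nf
    _ ≤ 2 * R * |x - y| := by gcongr

lemma exists_isSolutionFrom_truncField (hT : 0 ≤ T) (hR : 0 ≤ R) (hγ : Continuous γ) (c : ℝ) :
    ∃ ψ, IsSolutionFrom (truncField R γ) T c ψ := by
  obtain ⟨K, hK⟩ := isCompact_Icc.exists_bound_of_continuousOn (hγ.continuousOn (s := Icc 0 T))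
  refine exists_isSolutionFrom (L := R ^ 2 + K) hT (fun x => continuous_const.add hγ)
    (fun t ht x => (abs_add_le _ _).trans (add_le_add ?_ (hK t ht)))
    (lipschitzWith_truncField hR γ) c
  rw [abs_of_nonneg (sq_nonneg _)]
  exact pow_le_pow_left₀ (le_min (abs_nonneg _) hR) (min_le_right _ _) 2

lemma isPeriodicSolution_truncField_iff (hT : 0 < T) (hR : 0 ≤ R) (hγ : ∀ t, -γ t < R ^ 2) :
    IsPeriodicSolution (truncField R γ) T φ ↔ IsPeriodicSolution (normalField γ) T φ := by
  constructor <;> intro h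
  · have hφ := h.abs_apply_lt hT fun t x hx => (truncField_pos hγ t x hx).ne'
    exact h.congr fun t => truncField_eq_normalField (hφ t).le γ t
  · have hφ := h.abs_apply_lt hT fun t x hx => (normalField_pos hR hγ t x hx).ne'
    exact h.congr fun t => (truncField_eq_normalField (hφ t).le γ t).symm

theorem exists_two_isPeriodicSolution_normalField (hT : 0 < T) (hγc : Continuous γ)
    (hγp : Function.Periodic γ T) (hp : Differentiable ℝ p) (hpT : Function.Periodic p T)
    (hupper : ∀ t, p t ^ 2 + γ t < deriv p t) :
    ∃ φ₁ φ₂, IsPeriodicSolution (normalField γ) T φ₁ ∧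
      IsPeriodicSolution (normalField γ) T φ₂ ∧ φ₁ 0 < φ₂ 0 := by
  obtain ⟨K, hK⟩ := exists_abs_le_of_periodic hT hγc hγp
  have hK0 : 0 ≤ K := (abs_nonneg _).trans (hK 0)
  have hR : 0 ≤ K + 1 := by positivity
  have hγR : ∀ t, -γ t < (K + 1) ^ 2 := fun t => by nlinarith [neg_le_of_abs_le (hK t)]
  obtain ⟨φ₁, φ₂, h₁, h₂, hlt₁, hlt₂⟩ := exists_two_isPeriodicSolution_of_deriv_gt hT
    (continuous_uncurry_truncField hγc _) (truncField_add_period hγp _)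
    (exists_isSolutionFrom_truncField hT.le hR hγc) (lipschitzWith_truncField hR γ)
    (truncField_pos hγR) hp hpT
    fun t => (truncField_le_normalField hR γ t (p t)).trans_lt (hupper t)
  exact ⟨φ₁, φ₂, (isPeriodicSolution_truncField_iff hT hR hγR).1 h₁,
    (isPeriodicSolution_truncField_iff hT hR hγR).1 h₂, hlt₁.trans hlt₂⟩

lemma exists_isPeriodicSolution_of_tendsto {m : ℝ} {u : ℕ → ℝ} (hT : 0 < T)
    (hγc : Continuous γ) (hγp : Function.Periodic γ T) (hu : Tendsto u atTop (𝓝 m))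
    (h : ∀ n, ∃ φ, IsPeriodicSolution (normalField fun t => γ t + u n) T φ) :
    ∃ φ, IsPeriodicSolution (normalField fun t => γ t + m) T φ := by
  choose φ hφ using h
  obtain ⟨K, hK⟩ := exists_abs_le_of_periodic hT hγc hγp
  obtain ⟨M, hM⟩ := hu.abs.bddAbove_range
  have hK0 : 0 ≤ K := (abs_nonneg _).trans (hK 0)
  have hM0 : 0 ≤ M := (abs_nonneg _).trans (hM ⟨0, rfl⟩)
  have hR : 0 ≤ K + M + 1 := by positivity
  have hbound : ∀ a, |a| ≤ M → ∀ t, -(γ t + a) < (K + M + 1) ^ 2 := fun a ha t => by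
    nlinarith [neg_le_of_abs_le (hK t), neg_le_of_abs_le ha]
  have hm := hbound m (le_of_tendsto' hu.abs fun n => hM ⟨n, rfl⟩)
  have hun := fun n => hbound (u n) (hM ⟨n, rfl⟩)
  have hmc : Continuous fun t => γ t + m := hγc.add continuous_const
  have htrunc := fun n => (isPeriodicSolution_truncField_iff hT hR (hun n)).2 (hφ n)
  obtain ⟨c, ψ, hψ, hψT⟩ := exists_fixedPoint_of_tendsto hT.le
    (exists_isSolutionFrom_truncField hT.le hR hmc) (lipschitzWith_truncField hR _)
    (ε := fun n => |u n - m|) (fun n t x => by simp [truncField])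
    (by simpa using (hu.sub_const m).abs) (fun n => (htrunc n).isSolutionFrom)
    (fun n => by simpa using (hφ n).2 0)
    (fun n => ((htrunc n).abs_apply_lt hT
      (fun t x hx => (truncField_pos (hun n) t x hx).ne') 0).le)
  obtain ⟨χ, hχ, -⟩ := exists_isPeriodicSolution_of_fixedPoint hT
    (continuous_uncurry_truncField hmc _) (truncField_add_period (fun t => by rw [hγp t]) _) hψ hψT
  exact ⟨χ, (isPeriodicSolution_truncField_iff hT hR hm).1 hχ⟩

end Truncation

/-! ### Exponential weights and linear equations -/

section Weight

variable {T : ℝ} {φ p : ℝ → ℝ}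

lemma hasDerivAt_weight (hφ : Continuous φ) (t : ℝ) :
    HasDerivAt (weight φ) (-2 * φ t * weight φ t) t :=
  ((hφ.integral_hasStrictDerivAt 0 t).hasDerivAt.const_mul (-2)).exp.congr_deriv (mul_comm _ _)

lemma hasDerivAt_weight_mul {p' t : ℝ} (hφ : Continuous φ) (hp : HasDerivAt p p' t) :
    HasDerivAt (fun t => weight φ t * p t) (weight φ t * (p' - 2 * φ t * p t)) t :=
  ((hasDerivAt_weight hφ t).mul hp).congr_deriv (by ring)

lemma continuous_weight (hφ : Continuous φ) : Continuous (weight φ) :=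
  continuous_iff_continuousAt.2 fun t => (hasDerivAt_weight hφ t).continuousAt

lemma weight_pos (φ : ℝ → ℝ) (t : ℝ) : 0 < weight φ t := Real.exp_pos _

lemma weight_zero (φ : ℝ → ℝ) : weight φ 0 = 1 := by simp [weight]

lemma weight_add_period (hφ : Continuous φ) (hφT : Function.Periodic φ T) (t : ℝ) :
    weight φ (t + T) = weight φ t * weight φ T := by
  have hadd := hφT.intervalIntegral_add_eq_add 0 t fun _ _ => hφ.intervalIntegrable _ _
  rw [zero_add] at hadd
  rw [weight, weight, weight, hadd, mul_add, Real.exp_add]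

lemma weight_eq_one_iff : weight φ T = 1 ↔ ∫ t in (0 : ℝ)..T, φ t = 0 := by
  simp [weight]

lemma integral_weight_pos (hT : 0 < T) (hφ : Continuous φ) :
    0 < ∫ t in (0 : ℝ)..T, weight φ t :=
  intervalIntegral.intervalIntegral_pos_of_pos ((continuous_weight hφ).intervalIntegrable _ _)
    (weight_pos φ) hT

lemma integral_weight_mul_add_period {g : ℝ → ℝ} (hφ : Continuous φ)
    (hφT : Function.Periodic φ T) (hg : Continuous g) (hgT : Function.Periodic g T) (t : ℝ) :
    ∫ s in (0 : ℝ)..t + T, weight φ s * g s =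
      (∫ s in (0 : ℝ)..T, weight φ s * g s) + weight φ T * ∫ s in (0 : ℝ)..t, weight φ s * g s := by
  have hc : Continuous fun s => weight φ s * g s := (continuous_weight hφ).mul hg
  rw [← intervalIntegral.integral_add_adjacent_intervals (hc.intervalIntegrable 0 T)
    (hc.intervalIntegrable T (t + T)), ← intervalIntegral.integral_const_mul]
  congr 1
  calc ∫ s in T..t + T, weight φ s * g s
      = ∫ s in (0 : ℝ)..t, weight φ (s + T) * g (s + T) := by
        rw [intervalIntegral.integral_comp_add_right (fun s => weight φ s * g s), zero_add]
    _ = ∫ s in (0 : ℝ)..t, weight φ T * (weight φ s * g s) := by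
        simp only [weight_add_period hφ hφT, hgT _, mul_assoc, mul_left_comm]

-- Variation of constants; the initial value `J T / (weight φ T - 1)` is the one that makes the
-- solution periodic.
lemma exists_periodic_hasDerivAt_linear {g : ℝ → ℝ} (hφ : Continuous φ)
    (hφT : Function.Periodic φ T) (hφ0 : ∫ t in (0 : ℝ)..T, φ t ≠ 0) (hg : Continuous g)
    (hgT : Function.Periodic g T) :
    ∃ d, Function.Periodic d T ∧ ∀ t, HasDerivAt d (2 * φ t * d t + g t) t := by
  set J : ℝ → ℝ := fun t => ∫ s in (0 : ℝ)..t, weight φ s * g s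
  have hJ : ∀ t, HasDerivAt J (weight φ t * g t) t := fun t =>
    (((continuous_weight hφ).mul hg).integral_hasStrictDerivAt 0 t).hasDerivAt
  have hWT : weight φ T - 1 ≠ 0 := sub_ne_zero.2 fun h => hφ0 (weight_eq_one_iff.1 h)
  have hW : ∀ t, weight φ t ≠ 0 := fun t => (weight_pos φ t).ne'
  refine ⟨fun t => (J T / (weight φ T - 1) + J t) / weight φ t, fun t => ?_, fun t => ?_⟩
  · simp only [J, integral_weight_mul_add_period hφ hφT hg hgT t, weight_add_period hφ hφT]
    have := hW t
    have := hW T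
    field_simp
    ring
  · refine (((hJ t).const_add (J T / (weight φ T - 1))).div (hasDerivAt_weight hφ t)
      (hW t)).congr_deriv ?_
    have := hW t
    dsimp only
    generalize J T / (weight φ T - 1) + J t = z
    field_simp
    ring

end Weight

/-! ### Periodic upper solutions and their levels -/

/-- The numbers `m` such that `x' = x ^ 2 + γ (t) + m` has a periodic `C¹` upper solution. Their
maximum turns out to be the discriminant of `x' = x ^ 2 + γ (t)`. -/
def upperSolutionLevels (T : ℝ) (γ : ℝ → ℝ) : Set ℝ :=
  {m | ∃ p ∈ periodicC1 T, ∀ t, p t ^ 2 + γ t + m ≤ deriv p t}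

section Levels

variable {T m D : ℝ} {γ φ ψ p : ℝ → ℝ}

lemma mem_upperSolutionLevels_of_isPeriodicSolution (hγc : Continuous γ)
    (hφ : IsPeriodicSolution (normalField fun t => γ t + m) T φ) :
    m ∈ upperSolutionLevels T γ := by
  refine ⟨φ, hφ.mem_periodicC1 (continuous_uncurry_normalField (by fun_prop)), fun t => ?_⟩
  rw [(hφ.1 t).deriv, normalField, add_assoc]

lemma upperSolutionLevels_nonempty (hT : 0 < T) (hγc : Continuous γ)
    (hγp : Function.Periodic γ T) : (upperSolutionLevels T γ).Nonempty := by
  obtain ⟨K, hK⟩ := exists_abs_le_of_periodic hT hγc hγp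
  refine ⟨-K, fun _ => 0, ⟨contDiff_const, fun _ => rfl⟩, fun t => ?_⟩
  rw [deriv_const]
  linarith [le_of_abs_le (hK t)]

lemma bddAbove_upperSolutionLevels (hT : 0 < T) (hγc : Continuous γ)
    (hγp : Function.Periodic γ T) : BddAbove (upperSolutionLevels T γ) := by
  obtain ⟨K, hK⟩ := exists_abs_le_of_periodic hT hγc hγp
  refine ⟨K, ?_⟩
  rintro m ⟨p, hp, hle⟩
  obtain ⟨s, hs⟩ := exists_forall_le_of_periodic hT hp.1.continuous hp.2
  have hcrit : deriv p s = 0 := IsLocalMax.deriv_eq_zero (Eventually.of_forall hs)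
  linarith [hle s, sq_nonneg (p s), neg_le_of_abs_le (hK s)]

lemma exists_two_isPeriodicSolution_of_lt (hT : 0 < T) (hγc : Continuous γ)
    (hγp : Function.Periodic γ T) {a : ℝ} (hm : m ∈ upperSolutionLevels T γ) (ham : a < m) :
    ∃ φ₁ φ₂, IsPeriodicSolution (normalField fun t => γ t + a) T φ₁ ∧
      IsPeriodicSolution (normalField fun t => γ t + a) T φ₂ ∧ φ₁ 0 < φ₂ 0 := by
  obtain ⟨p, hp, hle⟩ := hm
  exact exists_two_isPeriodicSolution_normalField hT (by fun_prop) (fun t => by rw [hγp t])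
    (hp.1.differentiable one_ne_zero) hp.2 fun t => by linarith [hle t]

-- If `d' = 2 φ d + 1` then `p = φ + e d` satisfies `p' - p ^ 2 - γ = e - (e d) ^ 2`.
lemma exists_pos_mem_upperSolutionLevels (hT : 0 < T) (hγc : Continuous γ)
    (hφ : IsPeriodicSolution (normalField γ) T φ) (hφ0 : ∫ t in (0 : ℝ)..T, φ t ≠ 0) :
    ∃ δ > 0, δ ∈ upperSolutionLevels T γ := by
  obtain ⟨d, hdT, hd⟩ := exists_periodic_hasDerivAt_linear (g := fun _ => 1) hφ.continuous hφ.2 hφ0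
    continuous_const fun _ => rfl
  have hdc : Continuous d := continuous_iff_continuousAt.2 fun t => (hd t).continuousAt
  have hφc := hφ.continuous
  obtain ⟨B, hB⟩ := exists_abs_le_of_periodic hT hdc hdT
  obtain ⟨e, he, heB⟩ : ∃ e > 0, e * B ^ 2 ≤ 1 / 2 := by
    refine ⟨1 / (2 * (B ^ 2 + 1)), by positivity, ?_⟩
    rw [div_mul_eq_mul_div, div_le_div_iff₀ (by positivity) (by positivity)]
    linarith
  have hp : ∀ t, HasDerivAt (fun t => φ t + e * d t)
      (φ t ^ 2 + γ t + e * (2 * φ t * d t + 1)) t := fun t => (hφ.1 t).add ((hd t).const_mul e)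
  refine ⟨e / 2, by positivity, _, mem_periodicC1_of_hasDerivAt hp (by fun_prop)
    (fun t => by rw [hφ.2 t, hdT t]), fun t => ?_⟩
  have hedB : e * d t ^ 2 ≤ 1 / 2 := heB.trans' (by
    rw [← sq_abs (d t)]
    gcongr
    exact hB t)
  rw [(hp t).deriv]
  nlinarith

theorem exists_zeroMean_isPeriodicSolution (hT : 0 < T) (hγc : Continuous γ)
    (hγp : Function.Periodic γ T) :
    ∃ D φ, IsPeriodicSolution (normalField fun t => γ t + D) T φ ∧
      ∫ t in (0 : ℝ)..T, φ t = 0 := by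
  have hbdd := bddAbove_upperSolutionLevels hT hγc hγp
  obtain ⟨u, -, hu, hmem⟩ := exists_seq_tendsto_sSup (upperSolutionLevels_nonempty hT hγc hγp) hbdd
  set D := sSup (upperSolutionLevels T γ)
  have hv : Tendsto (fun n : ℕ => u n - 1 / ((n : ℝ) + 1)) atTop (𝓝 D) := by
    simpa using hu.sub tendsto_one_div_add_atTop_nhds_zero_nat
  obtain ⟨φ, hφ⟩ := exists_isPeriodicSolution_of_tendsto hT hγc hγp hv fun n => by
    obtain ⟨φ, -, hφ, -⟩ := exists_two_isPeriodicSolution_of_lt hT hγc hγp (hmem n)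
      (sub_lt_self (u n) (Nat.one_div_pos_of_nat (n := n)))
    exact ⟨φ, hφ⟩
  refine ⟨D, φ, hφ, ?_⟩
  by_contra hφ0
  obtain ⟨δ, hδ, p, hp, hle⟩ := exists_pos_mem_upperSolutionLevels hT (by fun_prop) hφ hφ0
  exact (lt_add_of_pos_right D hδ).not_ge
    (le_csSup hbdd ⟨p, hp, fun t => by linarith [hle t]⟩)

/-! ### Periodic solutions of the normal form and their means -/

lemma exists_deriv_eq_of_integral_eq_zero (hT : 0 < T)
    (hφ : IsPeriodicSolution (normalField γ) T φ) (hφ0 : ∫ t in (0 : ℝ)..T, φ t = 0)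
    (hp : Differentiable ℝ p) (hpT : p T = p 0) :
    ∃ t, deriv p t = p t ^ 2 + γ t - (p t - φ t) ^ 2 := by
  have hder : ∀ t, HasDerivAt (fun t => weight φ t * (p t - φ t)) (weight φ t *
      (deriv p t - normalField γ t (φ t) - 2 * φ t * (p t - φ t))) t := fun t =>
    hasDerivAt_weight_mul hφ.continuous ((hp t).hasDerivAt.sub (hφ.1 t))
  obtain ⟨t, -, ht⟩ := exists_hasDerivAt_eq_zero hT
    (fun t _ => (hder t).continuousAt.continuousWithinAt)
    (by rw [weight_eq_one_iff.2 hφ0, weight_zero, hpT, ← zero_add T, hφ.2 0])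
    fun t _ => hder t
  have hzero := (mul_eq_zero.1 ht).resolve_left (weight_pos φ t).ne'
  rw [normalField] at hzero
  exact ⟨t, by linarith⟩

lemma weight_mul_sub_eq (hφ : IsPeriodicSolution (normalField γ) T φ)
    (hψ : IsPeriodicSolution (normalField γ) T ψ) (t : ℝ) :
    weight (fun s => (φ s + ψ s) / 2) t * (ψ t - φ t) = ψ 0 - φ 0 := by
  have hc : Continuous fun s => (φ s + ψ s) / 2 := (hφ.continuous.add hψ.continuous).div_const 2
  have hder : ∀ t, HasDerivAt (fun t => weight (fun s => (φ s + ψ s) / 2) t * (ψ t - φ t)) 0 t :=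
    fun t => (hasDerivAt_weight_mul hc ((hψ.1 t).sub (hφ.1 t))).congr_deriv (by
      simp only [normalField, Pi.sub_apply]
      ring)
  rw [is_const_of_deriv_eq_zero (fun t => (hder t).differentiableAt) (fun t => (hder t).deriv) t 0,
    weight_zero, one_mul]

lemma eq_of_apply_eq (hφ : IsPeriodicSolution (normalField γ) T φ)
    (hψ : IsPeriodicSolution (normalField γ) T ψ) {t : ℝ} (ht : ψ t = φ t) : ψ = φ := by
  have h0 : ψ 0 - φ 0 = 0 := by rw [← weight_mul_sub_eq hφ hψ t, ht, sub_self, mul_zero]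
  funext s
  have hs := weight_mul_sub_eq hφ hψ s
  rw [h0] at hs
  exact sub_eq_zero.1 ((mul_eq_zero.1 hs).resolve_left (weight_pos _ s).ne')

lemma eq_of_integral_eq_zero (hT : 0 < T) (hφ : IsPeriodicSolution (normalField γ) T φ)
    (hφ0 : ∫ t in (0 : ℝ)..T, φ t = 0) (hψ : IsPeriodicSolution (normalField γ) T ψ) : ψ = φ := by
  obtain ⟨t, ht⟩ := exists_deriv_eq_of_integral_eq_zero hT hφ hφ0
    (fun t => (hψ.1 t).differentiableAt) (by simpa using hψ.2 0)
  rw [(hψ.1 t).deriv, normalField, eq_comm, sub_eq_self] at ht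
  exact eq_of_apply_eq hφ hψ (sub_eq_zero.1 (pow_eq_zero_iff two_ne_zero |>.1 ht))

lemma integral_add_integral_eq_zero_of_ne (hφ : IsPeriodicSolution (normalField γ) T φ)
    (hψ : IsPeriodicSolution (normalField γ) T ψ) (hne : ψ ≠ φ) :
    (∫ t in (0 : ℝ)..T, φ t) + ∫ t in (0 : ℝ)..T, ψ t = 0 := by
  have hne0 : ψ 0 - φ 0 ≠ 0 := sub_ne_zero.2 fun h => hne (eq_of_apply_eq hφ hψ h)
  have hT := weight_mul_sub_eq hφ hψ T
  rw [← zero_add T, hψ.2 0, hφ.2 0, zero_add, mul_eq_right₀ hne0, weight_eq_one_iff,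
    intervalIntegral.integral_div, intervalIntegral.integral_add
      (hφ.continuous.intervalIntegrable _ _) (hψ.continuous.intervalIntegrable _ _)] at hT
  linarith

lemma isGreatest_upperSolutionLevels (hT : 0 < T) (hγc : Continuous γ)
    (hφ : IsPeriodicSolution (normalField fun t => γ t + D) T φ)
    (hφ0 : ∫ t in (0 : ℝ)..T, φ t = 0) : IsGreatest (upperSolutionLevels T γ) D := by
  refine ⟨mem_upperSolutionLevels_of_isPeriodicSolution hγc hφ, ?_⟩
  rintro m ⟨p, hp, hle⟩
  obtain ⟨t, ht⟩ := exists_deriv_eq_of_integral_eq_zero hT hφ hφ0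
    (hp.1.differentiable one_ne_zero) (by simpa using hp.2 0)
  linarith [hle t, sq_nonneg (p t - φ t)]

end Levels

/-! ### The variational characterizations of the discriminant -/

section Variational

variable {T m D : ℝ} {γ γ₁ γ₂ φ p q : ℝ → ℝ}

lemma le_lowerMu_iff (hT : 0 < T) (hγc : Continuous γ) (hγp : Function.Periodic γ T)
    (hp : p ∈ periodicC1 T) :
    m + average T γ ≤ lowerMu T γ p ↔ ∀ t, p t ^ 2 + γ t + m ≤ deriv p t := by
  have hc : Continuous fun t => p t ^ 2 + centered T γ t - deriv p t :=
    ((hp.1.continuous.pow 2).add (hγc.sub continuous_const)).sub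
      (continuous_deriv_of_mem_periodicC1 hp)
  have hper : Function.Periodic (fun t => p t ^ 2 + centered T γ t - deriv p t) T := fun t => by
    simp only [centered, hp.2 t, hγp t, periodic_deriv hp.2 t]
  rw [lowerMu, le_neg, csSup_le_iff (isCompact_Icc.image hc).bddAbove
    ((nonempty_Icc.2 hT.le).image _), forall_mem_image]
  constructor
  · intro h t
    obtain ⟨s, hs, hst⟩ := hper.exists_mem_Ico₀ hT t
    have hle := hst.trans_le (h (Ico_subset_Icc_self hs))
    simp only [centered] at hle
    linarith
  · intro h t _
    simp only [centered]
    linarith [h t]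

lemma isGreatest_lowerMu (hT : 0 < T) (hγc : Continuous γ) (hγp : Function.Periodic γ T)
    (h : IsGreatest (upperSolutionLevels T γ) D) :
    IsGreatest (lowerMu T γ '' periodicC1 T) (D + average T γ) := by
  have hub : ∀ p ∈ periodicC1 T, lowerMu T γ p ≤ D + average T γ := fun p hp =>
    sub_le_iff_le_add.1 (h.2 ⟨p, hp, (le_lowerMu_iff hT hγc hγp hp).1 (by rw [sub_add_cancel])⟩)
  obtain ⟨p, hp, hle⟩ := h.1
  exact ⟨⟨p, hp, (hub p hp).antisymm ((le_lowerMu_iff hT hγc hγp hp).2 hle)⟩,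
    forall_mem_image.2 hub⟩

lemma discriminant_eq (hT : 0 < T) (hγc : Continuous γ) (hγp : Function.Periodic γ T)
    (h : IsGreatest (upperSolutionLevels T γ) D) : discriminant T γ = D := by
  rw [discriminant, gammaStar, (isGreatest_lowerMu hT hγc hγp h).csSup_eq, add_sub_cancel_right]

theorem exists_isPeriodicSolution_discriminant (hT : 0 < T) (hγc : Continuous γ)
    (hγp : Function.Periodic γ T) :
    ∃ φ, IsPeriodicSolution (normalField fun t => γ t + discriminant T γ) T φ ∧
      ∫ t in (0 : ℝ)..T, φ t = 0 := by
  obtain ⟨D, φ, hφ, hφ0⟩ := exists_zeroMean_isPeriodicSolution hT hγc hγp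
  rw [discriminant_eq hT hγc hγp (isGreatest_upperSolutionLevels hT hγc hφ hφ0)]
  exact ⟨φ, hφ, hφ0⟩

theorem isGreatest_discriminant (hT : 0 < T) (hγc : Continuous γ)
    (hγp : Function.Periodic γ T) :
    IsGreatest (upperSolutionLevels T γ) (discriminant T γ) := by
  obtain ⟨φ, hφ, hφ0⟩ := exists_isPeriodicSolution_discriminant hT hγc hγp
  exact isGreatest_upperSolutionLevels hT hγc hφ hφ0

lemma discriminant_add_le_of_add_le (hT : 0 < T) (hγc₁ : Continuous γ₁)
    (hγp₁ : Function.Periodic γ₁ T) (hγc₂ : Continuous γ₂) (hγp₂ : Function.Periodic γ₂ T)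
    {c : ℝ} (h : ∀ t, γ₂ t + c ≤ γ₁ t) : discriminant T γ₁ + c ≤ discriminant T γ₂ := by
  obtain ⟨p, hp, hle⟩ := (isGreatest_discriminant hT hγc₁ hγp₁).1
  exact (isGreatest_discriminant hT hγc₂ hγp₂).2 ⟨p, hp, fun t => by linarith [h t, hle t]⟩

-- Integrate `(weight q * φ)'` over a period and complete the square.
lemma integral_weight_mul_sq_sub_centered (hγc : Continuous γ)
    (hφ : IsPeriodicSolution (normalField fun t => γ t + D) T φ) (hqc : Continuous q)
    (hq0 : ∫ t in (0 : ℝ)..T, q t = 0) :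
    ∫ t in (0 : ℝ)..T, weight q t * (q t ^ 2 - centered T γ t) =
      (D + average T γ) * (∫ t in (0 : ℝ)..T, weight q t) +
        ∫ t in (0 : ℝ)..T, weight q t * (q t - φ t) ^ 2 := by
  have hφc := hφ.continuous
  have hWc := continuous_weight hqc
  have hder : ∀ t, HasDerivAt (fun t => weight q t * φ t)
      (weight q t * (φ t ^ 2 + (γ t + D) - 2 * q t * φ t)) t := fun t =>
    hasDerivAt_weight_mul hqc (hφ.1 t)
  have hzero : ∫ t in (0 : ℝ)..T, weight q t * (φ t ^ 2 + (γ t + D) - 2 * q t * φ t) = 0 := by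
    rw [intervalIntegral.integral_eq_sub_of_hasDerivAt (fun t _ => hder t)
      (Continuous.intervalIntegrable (by fun_prop) _ _), weight_eq_one_iff.2 hq0, weight_zero,
      ← zero_add T, hφ.2 0, sub_self]
  have hsplit : ∀ t, weight q t * (q t ^ 2 - centered T γ t) =
      (D + average T γ) * weight q t + weight q t * (q t - φ t) ^ 2 -
        weight q t * (φ t ^ 2 + (γ t + D) - 2 * q t * φ t) := fun t => by
    unfold centered
    ring
  simp only [hsplit]
  rw [intervalIntegral.integral_sub (Continuous.intervalIntegrable (by fun_prop) _ _)
    (Continuous.intervalIntegrable (by fun_prop) _ _),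
    intervalIntegral.integral_add (Continuous.intervalIntegrable (by fun_prop) _ _)
    (Continuous.intervalIntegrable (by fun_prop) _ _), hzero,
    intervalIntegral.integral_const_mul, sub_zero]

lemma upperMu_eq (hT : 0 < T) (hγc : Continuous γ)
    (hφ : IsPeriodicSolution (normalField fun t => γ t + D) T φ) (hq : q ∈ periodicC1Zero T) :
    upperMu T γ q = D + average T γ + (∫ t in (0 : ℝ)..T, weight q t)⁻¹ *
      ∫ t in (0 : ℝ)..T, weight q t * (q t - φ t) ^ 2 := by
  have hqc : Continuous q := hq.1.1.continuous
  have hq0 : ∫ t in (0 : ℝ)..T, q t = 0 :=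
    (mul_eq_zero.1 hq.2).resolve_left (one_div_pos.2 hT).ne'
  have hpos := integral_weight_pos hT hqc
  rw [upperMu, integral_weight_mul_sq_sub_centered hγc hφ hqc hq0]
  field_simp

lemma isLeast_upperMu (hT : 0 < T) (hγc : Continuous γ)
    (hφ : IsPeriodicSolution (normalField fun t => γ t + D) T φ)
    (hφ0 : ∫ t in (0 : ℝ)..T, φ t = 0) :
    IsLeast (upperMu T γ '' periodicC1Zero T) (D + average T γ) := by
  constructor
  · have hmem : φ ∈ periodicC1Zero T :=
      ⟨hφ.mem_periodicC1 (continuous_uncurry_normalField (by fun_prop)),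
        by rw [average, hφ0, mul_zero]⟩
    exact ⟨φ, hmem, by simp [upperMu_eq hT hγc hφ hmem]⟩
  · rintro _ ⟨q, hq, rfl⟩
    rw [upperMu_eq hT hγc hφ hq]
    exact le_add_of_nonneg_right (mul_nonneg
      (inv_nonneg.2 (integral_weight_pos hT hq.1.1.continuous).le)
      (intervalIntegral.integral_nonneg hT.le fun t _ =>
        mul_nonneg (weight_pos q t).le (sq_nonneg _)))

theorem gammaStar_isGreatest_isLeast (hT : 0 < T) (hγc : Continuous γ)
    (hγp : Function.Periodic γ T) :
    IsGreatest (lowerMu T γ '' periodicC1 T) (gammaStar T γ) ∧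
      IsLeast (upperMu T γ '' periodicC1Zero T) (gammaStar T γ) := by
  obtain ⟨D, φ, hφ, hφ0⟩ := exists_zeroMean_isPeriodicSolution hT hγc hγp
  have h := isGreatest_lowerMu hT hγc hγp (isGreatest_upperSolutionLevels hT hγc hφ hφ0)
  rw [gammaStar, h.csSup_eq]
  exact ⟨h, isLeast_upperMu hT hγc hφ hφ0⟩

-- A periodic solution `φ` at the level `Δ` satisfies `0 = ∫ φ' = ∫ φ ^ 2 + ∫ γ + T Δ`.
theorem gammaStar_neg (hT : 0 < T) (hγc : Continuous γ) (hγp : Function.Periodic γ T)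
    {s t : ℝ} (hst : γ s ≠ γ t) : gammaStar T γ < 0 := by
  obtain ⟨φ, hφ, -⟩ := exists_isPeriodicSolution_discriminant hT hγc hγp
  have hφc := hφ.continuous
  have hpos : 0 < ∫ t in (0 : ℝ)..T, φ t ^ 2 := by
    refine intervalIntegral.integral_pos hT (by fun_prop) (fun t _ => sq_nonneg _) ?_
    by_contra! hle
    have hφ0 : φ = fun _ => 0 := eq_of_periodic_of_eqOn_Icc hT hφ.2 (fun _ => rfl) fun t ht =>
      pow_eq_zero_iff two_ne_zero |>.1 ((hle t ht).antisymm (sq_nonneg _))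
    subst hφ0
    have hconst : ∀ t, γ t + discriminant T γ = 0 := fun t => by
      simpa [normalField] using (hφ.1 t).unique (hasDerivAt_const t 0)
    exact hst (by linarith [hconst s, hconst t])
  have hder : ∀ t, HasDerivAt φ (φ t ^ 2 + (γ t + discriminant T γ)) t := hφ.1
  have hint : ∫ t in (0 : ℝ)..T, (φ t ^ 2 + (γ t + discriminant T γ)) = 0 := by
    rw [intervalIntegral.integral_eq_sub_of_hasDerivAt (fun t _ => hder t)
      (Continuous.intervalIntegrable (by fun_prop) _ _), ← zero_add T, hφ.2 0, sub_self]
  rw [intervalIntegral.integral_add (Continuous.intervalIntegrable (by fun_prop) _ _)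
    (Continuous.intervalIntegrable (by fun_prop) _ _), integral_add_const hγc] at hint
  have havg : ∫ t in (0 : ℝ)..T, γ t = T * average T γ := by
    rw [average]
    field_simp
  rw [havg, discriminant] at hint
  nlinarith

end Variational

/-! ### The number of periodic solutions of the normal form -/

section Counting

variable {T : ℝ} {γ φ : ℝ → ℝ}

theorem discriminant_nonneg_of_isPeriodicSolution (hT : 0 < T) (hγc : Continuous γ)
    (hγp : Function.Periodic γ T) (hφ : IsPeriodicSolution (normalField γ) T φ) :
    0 ≤ discriminant T γ :=
  (isGreatest_discriminant hT hγc hγp).2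
    (mem_upperSolutionLevels_of_isPeriodicSolution hγc (by simpa using hφ))

theorem exists_unique_isPeriodicSolution_of_discriminant_eq_zero (hT : 0 < T) (hγc : Continuous γ)
    (hγp : Function.Periodic γ T) (h : discriminant T γ = 0) :
    ∃ φ, IsPeriodicSolution (normalField γ) T φ ∧ ∫ t in (0 : ℝ)..T, φ t = 0 ∧
      ∀ ψ, IsPeriodicSolution (normalField γ) T ψ → ψ = φ := by
  obtain ⟨φ, hφ, hφ0⟩ := exists_isPeriodicSolution_discriminant hT hγc hγp
  simp only [h, add_zero] at hφ
  exact ⟨φ, hφ, hφ0, fun ψ hψ => eq_of_integral_eq_zero hT hφ hφ0 hψ⟩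

theorem exists_two_isPeriodicSolution_of_discriminant_pos (hT : 0 < T) (hγc : Continuous γ)
    (hγp : Function.Periodic γ T) (h : 0 < discriminant T γ) :
    ∃ φ₁ φ₂, φ₁ ≠ φ₂ ∧ IsPeriodicSolution (normalField γ) T φ₁ ∧
      IsPeriodicSolution (normalField γ) T φ₂ ∧
      ∫ t in (0 : ℝ)..T, φ₁ t ≠ 0 ∧ ∫ t in (0 : ℝ)..T, φ₂ t ≠ 0 ∧
      ∀ ψ, IsPeriodicSolution (normalField γ) T ψ → ψ = φ₁ ∨ ψ = φ₂ := by
  obtain ⟨φ₁, φ₂, h₁, h₂, hlt⟩ := exists_two_isPeriodicSolution_of_lt hT hγc hγp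
    (isGreatest_discriminant hT hγc hγp).1 h
  simp only [add_zero] at h₁ h₂
  have hne : φ₁ ≠ φ₂ := fun h => hlt.ne (congrFun h 0)
  have hmean₁ : ∫ t in (0 : ℝ)..T, φ₁ t ≠ 0 := fun h0 =>
    hne (eq_of_integral_eq_zero hT h₁ h0 h₂).symm
  have hmean₂ : ∫ t in (0 : ℝ)..T, φ₂ t ≠ 0 := fun h0 => hne (eq_of_integral_eq_zero hT h₂ h0 h₁)
  refine ⟨φ₁, φ₂, hne, h₁, h₂, hmean₁, hmean₂, fun ψ hψ => ?_⟩
  by_contra! hψne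
  -- Three distinct solutions would have pairwise opposite means.
  have hsum₁ := integral_add_integral_eq_zero_of_ne h₁ hψ hψne.1
  have hsum₂ := integral_add_integral_eq_zero_of_ne h₂ hψ hψne.2
  have hsum₁₂ := integral_add_integral_eq_zero_of_ne h₁ h₂ hne.symm
  exact hmean₁ (by linarith)

end Counting

/-! ### The displacement map of a Riccati equation -/

section Uniqueness

variable {f : ℝ → ℝ → ℝ} {T c : ℝ} {ψ ψ₁ ψ₂ : ℝ → ℝ}

lemma IsSolutionFrom.eqOn
    (hlip : ∀ M : ℝ, ∃ K : ℝ≥0, ∀ t ∈ Icc 0 T, LipschitzOnWith K (f t) {u | |u| ≤ M})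
    (h₁ : IsSolutionFrom f T c ψ₁) (h₂ : IsSolutionFrom f T c ψ₂) : EqOn ψ₁ ψ₂ (Icc 0 T) := by
  obtain ⟨M₁, hM₁⟩ := isCompact_Icc.exists_bound_of_continuousOn h₁.continuousOn
  obtain ⟨M₂, hM₂⟩ := isCompact_Icc.exists_bound_of_continuousOn h₂.continuousOn
  obtain ⟨K, hK⟩ := hlip (max M₁ M₂)
  exact ODE_solution_unique_of_mem_Icc_right (s := fun _ => {u | |u| ≤ max M₁ M₂})
    (fun t ht => hK t (Ico_subset_Icc_self ht))
    h₁.continuousOn h₁.hasDerivWithinAt_Ici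
    (fun t ht => (hM₁ t (Ico_subset_Icc_self ht)).trans (le_max_left _ _))
    h₂.continuousOn h₂.hasDerivWithinAt_Ici
    (fun t ht => (hM₂ t (Ico_subset_Icc_self ht)).trans (le_max_right _ _))
    (h₁.1.trans h₂.1.symm)

lemma IsSolutionFrom.displacement_eq (hT : 0 ≤ T)
    (hlip : ∀ M : ℝ, ∃ K : ℝ≥0, ∀ t ∈ Icc 0 T, LipschitzOnWith K (f t) {u | |u| ≤ M})
    (h : IsSolutionFrom f T c ψ) : displacement f T c = ψ T - c := by
  have hex : ∃ ψ, IsSolutionFrom f T c ψ := ⟨ψ, h⟩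
  rw [displacement, dif_pos hex, hex.choose_spec.eqOn hlip h ⟨hT, le_rfl⟩]

end Uniqueness

/-- The displacement `x ↦ P x - x` of the Möbius map `P` with fixed point `c` that is the
multiplication by `E` in the coordinate `x - c`, up to the quadratic correction governed by `I`.
The time-`T` maps of Riccati equations have this form around a periodic solution. -/
def mobiusDisplacement (E I c x : ℝ) : ℝ :=
  E * (x - c) / (1 - (x - c) * I) - (x - c)

section Mobius

variable {E I c x : ℝ}

lemma mobiusDisplacement_self : mobiusDisplacement E I c c = 0 := by
  simp [mobiusDisplacement]

lemma hasDerivAt_mobiusDisplacement (hx : 1 - (x - c) * I ≠ 0) :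
    HasDerivAt (mobiusDisplacement E I c) (E / (1 - (x - c) * I) ^ 2 - 1) x := by
  have h := (hasDerivAt_id' x).sub_const c
  refine (((h.const_mul E).div ((h.mul_const I).const_sub 1) hx).sub h).congr_deriv ?_
  field_simp
  ring

lemma deriv_mobiusDisplacement_self : deriv (mobiusDisplacement E I c) c = E - 1 := by
  rw [(hasDerivAt_mobiusDisplacement (by simp)).deriv]
  simp

lemma deriv_deriv_mobiusDisplacement_self :
    deriv (deriv (mobiusDisplacement E I c)) c = 2 * E * I := by
  have hnear : ∀ᶠ x in 𝓝 c, 1 - (x - c) * I ≠ 0 :=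
    ContinuousAt.eventually_ne (by fun_prop) (by simp)
  have hderiv : deriv (mobiusDisplacement E I c) =ᶠ[𝓝 c]
      fun x => E / (1 - (x - c) * I) ^ 2 - 1 :=
    hnear.mono fun x hx => (hasDerivAt_mobiusDisplacement hx).deriv
  have h := ((((hasDerivAt_id' c).sub_const c).mul_const I).const_sub 1).fun_pow 2
  have hderiv₂ : HasDerivAt (fun x => E / (1 - (x - c) * I) ^ 2 - 1) (2 * E * I) c :=
    (((hasDerivAt_const c E).div h (by simp)).sub_const 1).congr_deriv (by
      simp only [sub_self, zero_mul, sub_zero, one_pow, Nat.cast_ofNat, div_one]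
      ring)
  rw [hderiv.deriv_eq, hderiv₂.deriv]

lemma contDiffAt_mobiusDisplacement (n : WithTop ℕ∞) :
    ContDiffAt ℝ n (mobiusDisplacement E I c) c := by
  have h : ContDiffAt ℝ n (fun x : ℝ => x - c) c := contDiffAt_id.sub contDiffAt_const
  exact ((contDiffAt_const.mul h).div (contDiffAt_const.sub (h.mul contDiffAt_const))
    (by simp)).sub h

variable {f : ℝ → ℝ → ℝ} {T : ℝ} {φ : ℝ → ℝ}

lemma isHyperbolic_of_eventuallyEq_mobiusDisplacement
    (hex : ∀ᶠ x in 𝓝 (φ 0), ∃ ψ, IsSolutionFrom f T x ψ)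
    (h : displacement f T =ᶠ[𝓝 (φ 0)] mobiusDisplacement E I (φ 0)) (hE : E ≠ 1) :
    IsHyperbolic f T φ := by
  refine ⟨hex, (contDiffAt_mobiusDisplacement _).congr_of_eventuallyEq h, fun k hk => ?_, ?_⟩
  · rw [Nat.lt_one_iff.1 hk, iteratedDeriv_zero, h.eq_of_nhds, mobiusDisplacement_self]
  · rw [iteratedDeriv_one, h.deriv_eq, deriv_mobiusDisplacement_self]
    exact sub_ne_zero.2 hE

lemma isDouble_of_eventuallyEq_mobiusDisplacement
    (hex : ∀ᶠ x in 𝓝 (φ 0), ∃ ψ, IsSolutionFrom f T x ψ)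
    (h : displacement f T =ᶠ[𝓝 (φ 0)] mobiusDisplacement 1 I (φ 0)) (hI : I ≠ 0) :
    IsDouble f T φ := by
  refine ⟨hex, (contDiffAt_mobiusDisplacement _).congr_of_eventuallyEq h, fun k hk => ?_, ?_⟩
  · interval_cases k
    · rw [iteratedDeriv_zero, h.eq_of_nhds, mobiusDisplacement_self]
    · rw [iteratedDeriv_one, h.deriv_eq, deriv_mobiusDisplacement_self, sub_self]
  · rw [iteratedDeriv_succ, iteratedDeriv_one, h.deriv.deriv_eq,
      deriv_deriv_mobiusDisplacement_self]
    simpa using hI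

end Mobius

/-- The right-hand side of the Riccati equation `u' = a₂ u ^ 2 + a₁ u + a₀`. -/
def riccatiField (a₂ a₁ a₀ : ℝ → ℝ) (t u : ℝ) : ℝ :=
  a₂ t * u ^ 2 + a₁ t * u + a₀ t

/-- The fundamental solution of the linearization `v' = (2 a₂ φ + a₁) v` along `φ`. -/
def linearFlow (a₂ a₁ φ : ℝ → ℝ) : ℝ → ℝ :=
  weight fun t => -(a₂ t * φ t + a₁ t / 2)

/-- The integral governing the quadratic part of the flow of the Riccati equation around `φ`. -/
def quadraticFlow (a₂ a₁ φ : ℝ → ℝ) (t : ℝ) : ℝ :=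
  ∫ s in (0 : ℝ)..t, a₂ s * linearFlow a₂ a₁ φ s

/-- The solution of the Riccati equation that starts at distance `d` from a solution `φ`; it exists
as long as the denominator does not vanish. -/
def translatedSolution (a₂ a₁ φ : ℝ → ℝ) (d t : ℝ) : ℝ :=
  φ t + linearFlow a₂ a₁ φ t * d / (1 - d * quadraticFlow a₂ a₁ φ t)

section RiccatiDisplacement

variable {a₂ a₁ a₀ φ : ℝ → ℝ} {T : ℝ}

lemma exists_lipschitzOnWith_riccatiField (h₂ : Continuous a₂) (h₁ : Continuous a₁) (M : ℝ) :
    ∃ K : ℝ≥0, ∀ t ∈ Icc 0 T, LipschitzOnWith K (riccatiField a₂ a₁ a₀ t) {u | |u| ≤ M} := by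
  obtain ⟨K₂, hK₂⟩ := isCompact_Icc.exists_bound_of_continuousOn (h₂.continuousOn (s := Icc 0 T))
  obtain ⟨K₁, hK₁⟩ := isCompact_Icc.exists_bound_of_continuousOn (h₁.continuousOn (s := Icc 0 T))
  refine ⟨Real.toNNReal (K₂ * (M + M) + K₁), fun t ht => ?_⟩
  refine LipschitzOnWith.of_dist_le_mul fun u hu v hv => ?_
  have hslope : |a₂ t * (u + v) + a₁ t| ≤ K₂ * (M + M) + K₁ := by
    refine (abs_add_le _ _).trans (add_le_add ?_ (hK₁ t ht))
    rw [abs_mul]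
    exact mul_le_mul (hK₂ t ht) ((abs_add_le u v).trans (add_le_add hu hv)) (abs_nonneg _)
      ((abs_nonneg _).trans (hK₂ t ht))
  rw [Real.coe_toNNReal _ ((abs_nonneg _).trans hslope), Real.dist_eq, Real.dist_eq,
    show riccatiField a₂ a₁ a₀ t u - riccatiField a₂ a₁ a₀ t v =
      (a₂ t * (u + v) + a₁ t) * (u - v) by unfold riccatiField; ring, abs_mul]
  gcongr

lemma hasDerivAt_linearFlow (h₂ : Continuous a₂) (h₁ : Continuous a₁) (hφ : Continuous φ) (t : ℝ) :
    HasDerivAt (linearFlow a₂ a₁ φ) ((2 * a₂ t * φ t + a₁ t) * linearFlow a₂ a₁ φ t) t :=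
  (hasDerivAt_weight (by fun_prop) t).congr_deriv (by rw [linearFlow]; ring)

lemma continuous_mul_linearFlow (h₂ : Continuous a₂) (h₁ : Continuous a₁) (hφ : Continuous φ) :
    Continuous fun t => a₂ t * linearFlow a₂ a₁ φ t :=
  h₂.mul (continuous_weight (by fun_prop))

lemma hasDerivAt_quadraticFlow (h₂ : Continuous a₂) (h₁ : Continuous a₁) (hφ : Continuous φ)
    (t : ℝ) : HasDerivAt (quadraticFlow a₂ a₁ φ) (a₂ t * linearFlow a₂ a₁ φ t) t :=
  ((continuous_mul_linearFlow h₂ h₁ hφ).integral_hasStrictDerivAt 0 t).hasDerivAt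

lemma linearFlow_eq_one_iff :
    linearFlow a₂ a₁ φ T = 1 ↔ ∫ t in (0 : ℝ)..T, (a₂ t * φ t + a₁ t / 2) = 0 := by
  rw [linearFlow, weight_eq_one_iff, intervalIntegral.integral_neg, neg_eq_zero]

lemma quadraticFlow_ne_zero (hT : 0 < T) (h₂ : Continuous a₂) (h₁ : Continuous a₁)
    (hne : ∀ t, a₂ t ≠ 0) (hφ : Continuous φ) : quadraticFlow a₂ a₁ φ T ≠ 0 :=
  integral_ne_zero_of_forall_ne_zero hT (continuous_mul_linearFlow h₂ h₁ hφ) fun t =>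
    mul_ne_zero (hne t) (weight_pos _ t).ne'

/- The difference `v` to `φ` solves the Bernoulli equation `v' = (2 a₂ φ + a₁) v + a₂ v ^ 2`, which
is linear in `1 / v`. -/
lemma isSolutionFrom_translatedSolution {d : ℝ} (h₂ : Continuous a₂) (h₁ : Continuous a₁)
    (hφ : IsPeriodicSolution (riccatiField a₂ a₁ a₀) T φ)
    (hd : ∀ t ∈ Icc 0 T, 1 - d * quadraticFlow a₂ a₁ φ t ≠ 0) :
    IsSolutionFrom (riccatiField a₂ a₁ a₀) T (φ 0 + d) (translatedSolution a₂ a₁ φ d) := by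
  refine ⟨by simp [translatedSolution, linearFlow, quadraticFlow, weight_zero],
    fun t ht => HasDerivAt.hasDerivWithinAt ?_⟩
  have hE := hasDerivAt_linearFlow h₂ h₁ hφ.continuous t
  have hI := hasDerivAt_quadraticFlow h₂ h₁ hφ.continuous t
  have hne := hd t ht
  refine ((hφ.1 t).add ((hE.mul_const d).div ((hI.const_mul d).const_sub 1) hne)).congr_deriv ?_
  simp only [riccatiField, translatedSolution]
  field_simp
  ring

lemma eventually_isSolutionFrom_translatedSolution (h₂ : Continuous a₂) (h₁ : Continuous a₁)
    (hφ : IsPeriodicSolution (riccatiField a₂ a₁ a₀) T φ) :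
    ∀ᶠ x in 𝓝 (φ 0), IsSolutionFrom (riccatiField a₂ a₁ a₀) T x
      (translatedSolution a₂ a₁ φ (x - φ 0)) := by
  obtain ⟨B, hB⟩ := isCompact_Icc.exists_bound_of_continuousOn (s := Icc 0 T) fun t _ =>
    (hasDerivAt_quadraticFlow h₂ h₁ hφ.continuous t).continuousAt.continuousWithinAt
  have hlim : Tendsto (fun x => |x - φ 0| * B) (𝓝 (φ 0)) (𝓝 0) := by
    have : Continuous fun x => |x - φ 0| * B := by fun_prop
    simpa using this.tendsto (φ 0)
  filter_upwards [hlim.eventually (gt_mem_nhds one_pos)] with x hx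
  have hden : ∀ t ∈ Icc 0 T, 1 - (x - φ 0) * quadraticFlow a₂ a₁ φ t ≠ 0 := fun t ht h => by
    have habs := congrArg abs (sub_eq_zero.1 h)
    rw [abs_one, abs_mul] at habs
    exact (habs.le.trans (mul_le_mul_of_nonneg_left (hB t ht) (abs_nonneg _))).not_gt hx
  simpa only [add_sub_cancel] using isSolutionFrom_translatedSolution h₂ h₁ hφ hden

lemma displacement_riccatiField_eventuallyEq (hT : 0 ≤ T) (h₂ : Continuous a₂)
    (h₁ : Continuous a₁) (hφ : IsPeriodicSolution (riccatiField a₂ a₁ a₀) T φ) :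
    displacement (riccatiField a₂ a₁ a₀) T =ᶠ[𝓝 (φ 0)]
      mobiusDisplacement (linearFlow a₂ a₁ φ T) (quadraticFlow a₂ a₁ φ T) (φ 0) := by
  filter_upwards [eventually_isSolutionFrom_translatedSolution h₂ h₁ hφ] with x hx
  rw [hx.displacement_eq hT (exists_lipschitzOnWith_riccatiField h₂ h₁), translatedSolution,
    mobiusDisplacement, ← zero_add T, hφ.2 0, zero_add]
  ring

theorem isHyperbolic_riccatiField (hT : 0 ≤ T) (h₂ : Continuous a₂) (h₁ : Continuous a₁)
    (hφ : IsPeriodicSolution (riccatiField a₂ a₁ a₀) T φ)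
    (h : ∫ t in (0 : ℝ)..T, (a₂ t * φ t + a₁ t / 2) ≠ 0) :
    IsHyperbolic (riccatiField a₂ a₁ a₀) T φ :=
  isHyperbolic_of_eventuallyEq_mobiusDisplacement
    ((eventually_isSolutionFrom_translatedSolution h₂ h₁ hφ).mono fun _ hx => ⟨_, hx⟩)
    (displacement_riccatiField_eventuallyEq hT h₂ h₁ hφ) (linearFlow_eq_one_iff.not.2 h)

theorem isDouble_riccatiField (hT : 0 < T) (h₂ : Continuous a₂) (h₁ : Continuous a₁)
    (hne : ∀ t, a₂ t ≠ 0) (hφ : IsPeriodicSolution (riccatiField a₂ a₁ a₀) T φ)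
    (h : ∫ t in (0 : ℝ)..T, (a₂ t * φ t + a₁ t / 2) = 0) :
    IsDouble (riccatiField a₂ a₁ a₀) T φ :=
  isDouble_of_eventuallyEq_mobiusDisplacement
    ((eventually_isSolutionFrom_translatedSolution h₂ h₁ hφ).mono fun _ hx => ⟨_, hx⟩)
    (linearFlow_eq_one_iff.2 h ▸ displacement_riccatiField_eventuallyEq hT.le h₂ h₁ hφ)
    (quadraticFlow_ne_zero hT h₂ h₁ hne hφ.continuous)

end RiccatiDisplacement

/-! ### Reduction to the normal form -/

/-- The change of variables `x = a₂ u + A` to the normal form, with `A = shift a₂ a₁`. -/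
def toNormal (a₂ a₁ u : ℝ → ℝ) (t : ℝ) : ℝ :=
  a₂ t * u t + shift a₂ a₁ t

/-- The inverse of the change of variables `toNormal`, if `a₂` has no zeros. -/
def ofNormal (a₂ a₁ x : ℝ → ℝ) (t : ℝ) : ℝ :=
  (x t - shift a₂ a₁ t) / a₂ t

/-- The assumptions on a `T`-periodic Riccati equation `u' = a₂ u ^ 2 + a₁ u + a₀` under which it is
equivalent to its normal form, with a continuous `T`-periodic function `reducedGamma a₂ a₁ a₀`. -/
structure PeriodicCoefficients (T : ℝ) (a₂ a₁ a₀ : ℝ → ℝ) : Prop where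
  contDiff₂ : ContDiff ℝ 2 a₂
  contDiff₁ : ContDiff ℝ 1 a₁
  continuous₀ : Continuous a₀
  periodic₂ : Function.Periodic a₂ T
  periodic₁ : Function.Periodic a₁ T
  periodic₀ : Function.Periodic a₀ T
  ne_zero : ∀ t, a₂ t ≠ 0

namespace PeriodicCoefficients

variable {T m : ℝ} {a₂ a₁ a₀ u x : ℝ → ℝ}

lemma contDiff_shift (h : PeriodicCoefficients T a₂ a₁ a₀) : ContDiff ℝ 1 (shift a₂ a₁) :=
  contDiff_const.mul (h.contDiff₁.add
    (h.contDiff₂.deriv'.div (h.contDiff₂.of_le one_le_two) h.ne_zero))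

lemma hasDerivAt_coeff (h : PeriodicCoefficients T a₂ a₁ a₀) (t : ℝ) :
    HasDerivAt a₂ (deriv a₂ t) t :=
  (h.contDiff₂.differentiable two_ne_zero t).hasDerivAt

lemma shift_mem_periodicC1 (h : PeriodicCoefficients T a₂ a₁ a₀) :
    shift a₂ a₁ ∈ periodicC1 T :=
  ⟨h.contDiff_shift, fun t => by
    simp only [shift, h.periodic₁ t, h.periodic₂ t, periodic_deriv h.periodic₂ t]⟩

lemma continuous_reducedGamma (h : PeriodicCoefficients T a₂ a₁ a₀) :
    Continuous (reducedGamma a₂ a₁ a₀) :=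
  ((h.contDiff₂.continuous.mul h.continuous₀).sub (h.contDiff_shift.continuous.pow 2)).add
    (continuous_deriv_of_mem_periodicC1 h.shift_mem_periodicC1)

lemma periodic_reducedGamma (h : PeriodicCoefficients T a₂ a₁ a₀) :
    Function.Periodic (reducedGamma a₂ a₁ a₀) T := fun t => by
  simp only [reducedGamma, h.periodic₂ t, h.periodic₀ t, h.shift_mem_periodicC1.2 t,
    periodic_deriv h.shift_mem_periodicC1.2 t]

lemma toNormal_ofNormal (h : PeriodicCoefficients T a₂ a₁ a₀) (x : ℝ → ℝ) :
    toNormal a₂ a₁ (ofNormal a₂ a₁ x) = x := by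
  funext t
  rw [toNormal, ofNormal, mul_div_cancel₀ _ (h.ne_zero t), sub_add_cancel]

lemma ofNormal_toNormal (h : PeriodicCoefficients T a₂ a₁ a₀) (u : ℝ → ℝ) :
    ofNormal a₂ a₁ (toNormal a₂ a₁ u) = u := by
  funext t
  rw [ofNormal, toNormal, add_sub_cancel_right, mul_div_cancel_left₀ _ (h.ne_zero t)]

lemma periodic_toNormal (h : PeriodicCoefficients T a₂ a₁ a₀) (hu : Function.Periodic u T) :
    Function.Periodic (toNormal a₂ a₁ u) T := fun t => by
  simp only [toNormal, h.periodic₂ t, hu t, h.shift_mem_periodicC1.2 t]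

lemma periodic_ofNormal (h : PeriodicCoefficients T a₂ a₁ a₀) (hx : Function.Periodic x T) :
    Function.Periodic (ofNormal a₂ a₁ x) T := fun t => by
  simp only [ofNormal, h.periodic₂ t, hx t, h.shift_mem_periodicC1.2 t]

lemma hasDerivAt_toNormal (h : PeriodicCoefficients T a₂ a₁ a₀) {t u' : ℝ}
    (hu : HasDerivAt u u' t) :
    HasDerivAt (toNormal a₂ a₁ u)
      (normalField (reducedGamma a₂ a₁ a₀) t (toNormal a₂ a₁ u t) +
        a₂ t * (u' - riccatiField a₂ a₁ a₀ t (u t))) t := by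
  refine (((h.hasDerivAt_coeff t).mul hu).add
    (hasDerivAt_of_mem_periodicC1 h.shift_mem_periodicC1 t)).congr_deriv ?_
  have hA : 2 * a₂ t * shift a₂ a₁ t = a₂ t * a₁ t + deriv a₂ t := by
    have := h.ne_zero t
    rw [shift]
    field_simp
  simp only [normalField, reducedGamma, toNormal, riccatiField]
  linear_combination (-u t) * hA

lemma isPeriodicSolution_toNormal (h : PeriodicCoefficients T a₂ a₁ a₀)
    (hu : IsPeriodicSolution (riccatiField a₂ a₁ a₀) T u) :
    IsPeriodicSolution (normalField (reducedGamma a₂ a₁ a₀)) T (toNormal a₂ a₁ u) :=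
  ⟨fun t => (h.hasDerivAt_toNormal (hu.1 t)).congr_deriv (by rw [sub_self, mul_zero, add_zero]),
    h.periodic_toNormal hu.2⟩

lemma isPeriodicSolution_ofNormal (h : PeriodicCoefficients T a₂ a₁ a₀)
    (hx : IsPeriodicSolution (normalField (reducedGamma a₂ a₁ a₀)) T x) :
    IsPeriodicSolution (riccatiField a₂ a₁ a₀) T (ofNormal a₂ a₁ x) := by
  refine ⟨fun t => ?_, h.periodic_ofNormal hx.2⟩
  have hu : HasDerivAt (ofNormal a₂ a₁ x) _ t :=
    ((hx.1 t).sub (hasDerivAt_of_mem_periodicC1 h.shift_mem_periodicC1 t)).div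
      (h.hasDerivAt_coeff t) (h.ne_zero t)
  have hdefect := (h.hasDerivAt_toNormal hu).unique
    (h.toNormal_ofNormal x ▸ hx.1 t : HasDerivAt (toNormal a₂ a₁ (ofNormal a₂ a₁ x)) _ t)
  rw [h.toNormal_ofNormal, add_eq_left, mul_eq_zero] at hdefect
  exact hu.congr_deriv (sub_eq_zero.1 (hdefect.resolve_left (h.ne_zero t)))

lemma integral_shift (h : PeriodicCoefficients T a₂ a₁ a₀) :
    ∫ t in (0 : ℝ)..T, shift a₂ a₁ t = ∫ t in (0 : ℝ)..T, a₁ t / 2 := by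
  have hlog : ∀ t, HasDerivAt (fun t => Real.log (a₂ t) / 2) (shift a₂ a₁ t - a₁ t / 2) t :=
    fun t => (((h.hasDerivAt_coeff t).log (h.ne_zero t)).div_const 2).congr_deriv
      (by rw [shift]; ring)
  have hshift := h.contDiff_shift.continuous
  have h₁ := h.contDiff₁.continuous
  have hFTC := intervalIntegral.integral_eq_sub_of_hasDerivAt (a := 0) (b := T)
    (fun t _ => hlog t) (Continuous.intervalIntegrable (by fun_prop) _ _)
  rw [← zero_add T, h.periodic₂ 0, sub_self, zero_add, intervalIntegral.integral_sub
    (Continuous.intervalIntegrable (by fun_prop) _ _)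
    (Continuous.intervalIntegrable (by fun_prop) _ _)] at hFTC
  exact sub_eq_zero.1 hFTC

lemma integral_toNormal (h : PeriodicCoefficients T a₂ a₁ a₀) (hu : Continuous u) :
    ∫ t in (0 : ℝ)..T, toNormal a₂ a₁ u t = ∫ t in (0 : ℝ)..T, (a₂ t * u t + a₁ t / 2) := by
  have hshift := h.contDiff_shift.continuous
  have h₂ := h.contDiff₂.continuous
  have h₁ := h.contDiff₁.continuous
  simp only [toNormal]
  rw [intervalIntegral.integral_add (Continuous.intervalIntegrable (by fun_prop) _ _)
    (Continuous.intervalIntegrable (by fun_prop) _ _), h.integral_shift,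
    ← intervalIntegral.integral_add (Continuous.intervalIntegrable (by fun_prop) _ _)
    (Continuous.intervalIntegrable (by fun_prop) _ _)]

lemma integral_ofNormal (h : PeriodicCoefficients T a₂ a₁ a₀)
    (hx : IsPeriodicSolution (normalField (reducedGamma a₂ a₁ a₀)) T x) :
    ∫ t in (0 : ℝ)..T, (a₂ t * ofNormal a₂ a₁ x t + a₁ t / 2) = ∫ t in (0 : ℝ)..T, x t := by
  rw [← h.integral_toNormal (h.isPeriodicSolution_ofNormal hx).continuous, h.toNormal_ofNormal]

lemma integral_reducedGamma (h : PeriodicCoefficients T a₂ a₁ a₀) :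
    ∫ t in (0 : ℝ)..T, reducedGamma a₂ a₁ a₀ t =
      (∫ t in (0 : ℝ)..T, a₂ t * a₀ t) - ∫ t in (0 : ℝ)..T, shift a₂ a₁ t ^ 2 := by
  have hshift := h.contDiff_shift.continuous
  have h₂ := h.contDiff₂.continuous
  have h₀ := h.continuous₀
  have hderiv := continuous_deriv_of_mem_periodicC1 h.shift_mem_periodicC1
  have hFTC := intervalIntegral.integral_eq_sub_of_hasDerivAt (a := 0) (b := T)
    (fun t _ => hasDerivAt_of_mem_periodicC1 h.shift_mem_periodicC1 t)
    (hderiv.intervalIntegrable _ _)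
  rw [← zero_add T, h.shift_mem_periodicC1.2 0, sub_self, zero_add] at hFTC
  simp only [reducedGamma]
  rw [intervalIntegral.integral_add (Continuous.intervalIntegrable (by fun_prop) _ _)
    (hderiv.intervalIntegrable _ _), hFTC, add_zero,
    intervalIntegral.integral_sub (Continuous.intervalIntegrable (by fun_prop) _ _)
    (Continuous.intervalIntegrable (by fun_prop) _ _)]

lemma le_discriminant (h : PeriodicCoefficients T a₂ a₁ a₀) (hT : 0 < T) (hu : u ∈ periodicC1 T)
    (hm : ∀ t, m ≤ a₂ t * (deriv u t - riccatiField a₂ a₁ a₀ t (u t))) :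
    m ≤ discriminant T (reducedGamma a₂ a₁ a₀) := by
  refine (isGreatest_discriminant hT h.continuous_reducedGamma h.periodic_reducedGamma).2
    ⟨toNormal a₂ a₁ u, ⟨?_, h.periodic_toNormal hu.2⟩, fun t => ?_⟩
  · exact ((h.contDiff₂.of_le one_le_two).mul hu.1).add h.contDiff_shift
  · rw [(h.hasDerivAt_toNormal (hasDerivAt_of_mem_periodicC1 hu t)).deriv, normalField]
    exact add_le_add_right (hm t) _

theorem discriminant_nonneg (h : PeriodicCoefficients T a₂ a₁ a₀) (hT : 0 < T)
    (hu : IsPeriodicSolution (riccatiField a₂ a₁ a₀) T u) :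
    0 ≤ discriminant T (reducedGamma a₂ a₁ a₀) :=
  discriminant_nonneg_of_isPeriodicSolution hT h.continuous_reducedGamma h.periodic_reducedGamma
    (h.isPeriodicSolution_toNormal hu)

theorem exists_unique_isDouble (h : PeriodicCoefficients T a₂ a₁ a₀) (hT : 0 < T)
    (hΔ : discriminant T (reducedGamma a₂ a₁ a₀) = 0) :
    ∃ φ, IsPeriodicSolution (riccatiField a₂ a₁ a₀) T φ ∧
      IsDouble (riccatiField a₂ a₁ a₀) T φ ∧
      ∀ ψ, IsPeriodicSolution (riccatiField a₂ a₁ a₀) T ψ → ψ = φ := by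
  obtain ⟨x, hx, hx0, huniq⟩ := exists_unique_isPeriodicSolution_of_discriminant_eq_zero hT
    h.continuous_reducedGamma h.periodic_reducedGamma hΔ
  have hu := h.isPeriodicSolution_ofNormal hx
  refine ⟨ofNormal a₂ a₁ x, hu, isDouble_riccatiField hT h.contDiff₂.continuous
    h.contDiff₁.continuous h.ne_zero hu ((h.integral_ofNormal hx).trans hx0), fun ψ hψ => ?_⟩
  rw [← huniq _ (h.isPeriodicSolution_toNormal hψ), h.ofNormal_toNormal]

theorem exists_two_isHyperbolic (h : PeriodicCoefficients T a₂ a₁ a₀) (hT : 0 < T)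
    (hΔ : 0 < discriminant T (reducedGamma a₂ a₁ a₀)) :
    ∃ φ₁ φ₂, φ₁ ≠ φ₂ ∧
      IsPeriodicSolution (riccatiField a₂ a₁ a₀) T φ₁ ∧
      IsPeriodicSolution (riccatiField a₂ a₁ a₀) T φ₂ ∧
      IsHyperbolic (riccatiField a₂ a₁ a₀) T φ₁ ∧
      IsHyperbolic (riccatiField a₂ a₁ a₀) T φ₂ ∧
      ∀ ψ, IsPeriodicSolution (riccatiField a₂ a₁ a₀) T ψ → ψ = φ₁ ∨ ψ = φ₂ := by
  obtain ⟨x₁, x₂, hne, hx₁, hx₂, hx₁0, hx₂0, hall⟩ :=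
    exists_two_isPeriodicSolution_of_discriminant_pos hT h.continuous_reducedGamma
      h.periodic_reducedGamma hΔ
  have hhyp : ∀ x, IsPeriodicSolution (normalField (reducedGamma a₂ a₁ a₀)) T x →
      ∫ t in (0 : ℝ)..T, x t ≠ 0 →
      IsHyperbolic (riccatiField a₂ a₁ a₀) T (ofNormal a₂ a₁ x) := fun x hx hx0 =>
    isHyperbolic_riccatiField hT.le h.contDiff₂.continuous h.contDiff₁.continuous
      (h.isPeriodicSolution_ofNormal hx) (h.integral_ofNormal hx ▸ hx0)
  refine ⟨ofNormal a₂ a₁ x₁, ofNormal a₂ a₁ x₂, fun e => hne ?_,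
    h.isPeriodicSolution_ofNormal hx₁, h.isPeriodicSolution_ofNormal hx₂,
    hhyp x₁ hx₁ hx₁0, hhyp x₂ hx₂ hx₂0, fun ψ hψ => ?_⟩
  · rw [← h.toNormal_ofNormal x₁, e, h.toNormal_ofNormal]
  · rw [← h.ofNormal_toNormal ψ]
    exact (hall _ (h.isPeriodicSolution_toNormal hψ)).imp (congrArg _) (congrArg _)

end PeriodicCoefficients

/-! ### The family -/

section Poisson

open Complex in
/- The Poisson integral formula for the constant function `1`, at the point `r * I` of the disk. -/
lemma integral_one_sub_sq_div {r : ℝ} (hr : |r| < 1) :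
    ∫ θ in (0 : ℝ)..2 * Real.pi, (1 - r ^ 2) / (1 + r ^ 2 - 2 * r * Real.sin θ) =
      2 * Real.pi := by
  have hmem : (r * I : ℂ) ∈ Metric.ball 0 1 := by simpa using hr
  have hmean := InnerProductSpace.HarmonicOnNhd.circleAverage_poissonKernel_smul
    (InnerProductSpace.harmonicOnNhd_const (1 : ℝ)) hmem
  have hkernel : ∀ θ : ℝ, poissonKernel 0 (r * I) (circleMap 0 1 θ) =
      (1 - r ^ 2) / (1 + r ^ 2 - 2 * r * Real.sin θ) := fun θ => by
    have hdist : ‖circleMap 0 1 θ - r * I‖ ^ 2 = 1 + r ^ 2 - 2 * r * Real.sin θ := by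
      rw [Complex.sq_norm, normSq_apply]
      simp only [circleMap_zero, ofReal_one, one_mul, sub_re, exp_re, mul_re, ofReal_re, I_re,
        mul_zero, ofReal_im, I_im, mul_one, sub_self, Real.exp_zero, mul_im, add_zero, sub_zero,
        sub_im, exp_im]
      linear_combination Real.sin_sq_add_cos_sq θ
    rw [poissonKernel_def]
    simp [hdist]
  simp only [Real.circleAverage_def, Pi.mul_apply, hkernel, smul_eq_mul, mul_one] at hmean
  rwa [inv_mul_eq_iff_eq_mul₀ Real.two_pi_pos.ne', mul_one] at hmean

lemma integral_one_div_sub_sin {a : ℝ} (ha : 1 < a) :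
    ∫ t in (0 : ℝ)..2 * Real.pi, 1 / (a - Real.sin t) = 2 * Real.pi / √(a ^ 2 - 1) := by
  set b := √(a ^ 2 - 1)
  have hb : 0 < b := Real.sqrt_pos.2 (by nlinarith)
  have hb2 : b ^ 2 = a ^ 2 - 1 := Real.sq_sqrt (by nlinarith)
  have hr : |a - b| < 1 := by rw [abs_lt]; constructor <;> nlinarith
  rw [eq_div_iff hb.ne', ← intervalIntegral.integral_mul_const]
  refine (intervalIntegral.integral_congr fun t _ => ?_).trans (integral_one_sub_sq_div hr)
  have hsin : a - Real.sin t ≠ 0 := by linarith [Real.sin_le_one t]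
  have hab : a - b ≠ 0 := by nlinarith
  rw [show 1 + (a - b) ^ 2 - 2 * (a - b) * Real.sin t = 2 * (a - b) * (a - Real.sin t) by
    linear_combination hb2, show 1 - (a - b) ^ 2 = 2 * (a - b) * b by linear_combination hb2]
  field_simp

end Poisson

section Family

variable {η h : ℝ}

lemma sin_sub_two_neg (t : ℝ) : Real.sin t - 2 < 0 := by
  linarith [Real.sin_le_one t]

lemma familyField_eq_riccatiField (η : ℝ) : familyField η =
    riccatiField (fun t => Real.sin t - 2) (fun _ => 0) (fun t => η - Real.cos t) := by
  funext t u
  rw [familyField, riccatiField]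
  ring

lemma periodicCoefficients_family (η : ℝ) : PeriodicCoefficients (2 * Real.pi)
    (fun t => Real.sin t - 2) (fun _ => 0) (fun t => η - Real.cos t) where
  contDiff₂ := by fun_prop
  contDiff₁ := contDiff_const
  continuous₀ := by fun_prop
  periodic₂ := Real.sin_periodic.sub (fun _ => rfl)
  periodic₁ := fun _ => rfl
  periodic₀ := Function.Periodic.sub (fun _ => rfl) Real.cos_periodic
  ne_zero t := (sin_sub_two_neg t).ne

lemma continuous_familyGamma (η : ℝ) : Continuous (familyGamma η) :=
  (periodicCoefficients_family η).continuous_reducedGamma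

lemma periodic_familyGamma (η : ℝ) : Function.Periodic (familyGamma η) (2 * Real.pi) :=
  (periodicCoefficients_family η).periodic_reducedGamma

lemma familyGamma_add (η h t : ℝ) :
    familyGamma (η + h) t = familyGamma η t + h * (Real.sin t - 2) := by
  simp only [familyGamma, reducedGamma]
  ring

lemma add_le_familyDiscriminant_add (hh : 0 ≤ h) :
    familyDiscriminant η + h ≤ familyDiscriminant (η + h) :=
  discriminant_add_le_of_add_le Real.two_pi_pos (continuous_familyGamma _)
    (periodic_familyGamma _) (continuous_familyGamma _) (periodic_familyGamma _) fun t => by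
      rw [familyGamma_add]
      nlinarith [Real.sin_le_one t]

lemma familyDiscriminant_add_le (hh : 0 ≤ h) :
    familyDiscriminant (η + h) ≤ familyDiscriminant η + 3 * h := by
  have hle := discriminant_add_le_of_add_le (c := -(3 * h)) Real.two_pi_pos
    (continuous_familyGamma (η + h)) (periodic_familyGamma (η + h)) (continuous_familyGamma η)
    (periodic_familyGamma η) fun t => by
      rw [familyGamma_add]
      nlinarith [Real.neg_one_le_sin t]
  rwa [← sub_eq_add_neg, sub_le_iff_le_add] at hle

lemma strictMono_familyDiscriminant : StrictMono familyDiscriminant := fun x y hxy => by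
  have hle := add_le_familyDiscriminant_add (η := x) (sub_pos.2 hxy).le
  rw [add_sub_cancel] at hle
  linarith

lemma continuous_familyDiscriminant : Continuous familyDiscriminant := by
  refine (LipschitzWith.of_le_add_mul 3 fun x y => ?_).continuous
  rcases le_total x y with hxy | hyx
  · exact (strictMono_familyDiscriminant.monotone hxy).trans
      (le_add_of_nonneg_right (by positivity))
  · have hle := familyDiscriminant_add_le (η := y) (sub_nonneg.2 hyx)
    rwa [add_sub_cancel, ← abs_of_nonneg (sub_nonneg.2 hyx), ← Real.dist_eq] at hle

-- The witness `u = -sin t / 4` becomes a strict upper solution in the normal form.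
lemma familyDiscriminant_one_pos : 0 < familyDiscriminant 1 := by
  have hu : ∀ t, HasDerivAt (fun t => -Real.sin t / 4) (-Real.cos t / 4) t := fun t =>
    (Real.hasDerivAt_sin t).fun_neg.div_const 4
  refine (by norm_num : (0 : ℝ) < 1 / 4).trans_le <|
    (periodicCoefficients_family 1).le_discriminant Real.two_pi_pos
      (mem_periodicC1_of_hasDerivAt hu (by fun_prop) fun t => by simp) fun t => ?_
  rw [(hu t).deriv, ← familyField_eq_riccatiField, familyField]
  have hdefect : 1 / 4 ≤
      (Real.sin t - 2) * (-Real.sin t / 4) ^ 2 + 1 - Real.cos t - -Real.cos t / 4 := by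
    nlinarith [Real.neg_one_le_sin t, Real.sin_sq_add_cos_sq t, Real.cos_le_one t,
      sq_nonneg (Real.sin t), sq_nonneg (1 - Real.cos t),
      mul_nonneg (sq_nonneg (Real.sin t)) (neg_le_iff_add_nonneg.1 (Real.neg_one_le_sin t))]
  nlinarith [Real.sin_le_one t]

lemma shift_family (t : ℝ) : shift (fun t => Real.sin t - 2) (fun _ => 0) t =
    Real.cos t / ((Real.sin t - 2) * 2) := by
  rw [shift, ((Real.hasDerivAt_sin t).sub_const 2).deriv, zero_add, one_div_mul_eq_div, div_div]

lemma hasDerivAt_shift_family (t : ℝ) :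
    HasDerivAt (shift (fun t => Real.sin t - 2) fun _ => 0)
      ((2 * Real.sin t - 1) / (2 * (Real.sin t - 2) ^ 2)) t := by
  have hne := (sin_sub_two_neg t).ne
  rw [funext shift_family]
  refine ((Real.hasDerivAt_cos t).fun_div (((Real.hasDerivAt_sin t).sub_const 2).mul_const 2)
    (mul_ne_zero hne two_ne_zero)).congr_deriv ?_
  field_simp
  linear_combination -Real.sin_sq_add_cos_sq t

lemma integral_shift_family_sq :
    ∫ t in (0 : ℝ)..2 * Real.pi, shift (fun t => Real.sin t - 2) (fun _ => 0) t ^ 2 =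
      2 * Real.pi * ((2 * √3 - 3) / 12) := by
  have hprim : ∀ t, HasDerivAt (fun t => (Real.cos t / (2 - Real.sin t) - t) / 4)
      (shift (fun t => Real.sin t - 2) (fun _ => 0) t ^ 2 - 1 / 2 * (1 / (2 - Real.sin t))) t :=
    fun t => by
      have hne : 2 - Real.sin t ≠ 0 := by linarith [sin_sub_two_neg t]
      refine ((((Real.hasDerivAt_cos t).fun_div ((Real.hasDerivAt_sin t).const_sub 2) hne).sub
        (hasDerivAt_id' t)).div_const 4).congr_deriv ?_
      rw [shift_family, ← neg_sub 2]
      field_simp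
      ring
  have hinv : Continuous fun t => 1 / 2 * (1 / (2 - Real.sin t)) :=
    continuous_const.mul (continuous_const.div (by fun_prop) fun t => by
      linarith [sin_sub_two_neg t])
  have hshift : Continuous fun t => shift (fun t => Real.sin t - 2) (fun _ => 0) t ^ 2 :=
    (periodicCoefficients_family 0).contDiff_shift.continuous.pow 2
  have hFTC := intervalIntegral.integral_eq_sub_of_hasDerivAt (a := 0) (b := 2 * Real.pi)
    (fun t _ => hprim t) ((hshift.sub hinv).intervalIntegrable _ _)
  rw [intervalIntegral.integral_sub (hshift.intervalIntegrable _ _) (hinv.intervalIntegrable _ _),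
    intervalIntegral.integral_const_mul, integral_one_div_sub_sin one_lt_two,
    show (2 : ℝ) ^ 2 - 1 = 3 by norm_num, Real.cos_two_pi, Real.sin_two_pi, Real.cos_zero,
    Real.sin_zero] at hFTC
  have h3 : 1 / √3 = √3 / 3 := by
    rw [div_eq_div_iff (by positivity) (by norm_num), one_mul, Real.mul_self_sqrt (by norm_num)]
  linear_combination hFTC + Real.pi * h3

lemma average_familyGamma (η : ℝ) :
    average (2 * Real.pi) (familyGamma η) = (3 - 2 * √3) / 12 - 2 * η := by
  have hprod : ∫ t in (0 : ℝ)..2 * Real.pi, (Real.sin t - 2) * (η - Real.cos t) =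
      2 * Real.pi * (-2 * η) := by
    have hprim : ∀ t, HasDerivAt
        (fun t => -η * Real.cos t - Real.sin t ^ 2 / 2 - 2 * η * t + 2 * Real.sin t)
        ((Real.sin t - 2) * (η - Real.cos t)) t := fun t =>
      (((((Real.hasDerivAt_cos t).const_mul (-η)).sub
        (((Real.hasDerivAt_sin t).fun_pow 2).div_const 2)).sub
        ((hasDerivAt_id' t).const_mul (2 * η))).add
        ((Real.hasDerivAt_sin t).const_mul 2)).congr_deriv (by ring)
    rw [intervalIntegral.integral_eq_sub_of_hasDerivAt (fun t _ => hprim t)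
      (Continuous.intervalIntegrable (by fun_prop) _ _), Real.cos_two_pi, Real.sin_two_pi,
      Real.cos_zero, Real.sin_zero]
    ring
  rw [average, familyGamma, (periodicCoefficients_family η).integral_reducedGamma, hprod,
    integral_shift_family_sq]
  field_simp
  ring

lemma familyGamma_zero_ne_familyGamma_pi (η : ℝ) :
    familyGamma η 0 ≠ familyGamma η Real.pi := by
  simp only [familyGamma, reducedGamma, shift_family, (hasDerivAt_shift_family _).deriv,
    Real.sin_zero, Real.cos_zero, Real.sin_pi, Real.cos_pi]
  intro h
  linarith

lemma familyDiscriminant_neg : familyDiscriminant ((3 - 2 * √3) / 24) < 0 := by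
  rw [familyDiscriminant, discriminant, average_familyGamma]
  have := gammaStar_neg Real.two_pi_pos (continuous_familyGamma _) (periodic_familyGamma _)
    (familyGamma_zero_ne_familyGamma_pi ((3 - 2 * √3) / 24))
  linarith

end Family

end Riccati

end


theorem mainTheorem5 :
    -- the number `γ*` in the discriminant is both the stated maximum and the stated minimum
    (∀ η : ℝ,
      IsGreatest
        (Riccati.lowerMu (2 * Real.pi) (Riccati.familyGamma η) ''
          Riccati.periodicC1 (2 * Real.pi))
        (Riccati.gammaStar (2 * Real.pi) (Riccati.familyGamma η)) ∧
      IsLeast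
        (Riccati.upperMu (2 * Real.pi) (Riccati.familyGamma η) ''
          Riccati.periodicC1Zero (2 * Real.pi))
        (Riccati.gammaStar (2 * Real.pi) (Riccati.familyGamma η))) ∧
    ∃ ηs : ℝ, ηs ∈ Set.Ioo ((3 - 2 * Real.sqrt 3) / 24) 1 ∧
      (∀ η : ℝ, Riccati.familyDiscriminant η = 0 ↔ η = ηs) ∧
      (∀ η : ℝ, η < ηs → Riccati.familyDiscriminant η < 0) ∧
      (∀ η : ℝ, ηs < η → 0 < Riccati.familyDiscriminant η) ∧
      -- below `ηs` there are no periodic solutions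
      (∀ η : ℝ, η < ηs →
        ¬ ∃ φ, Riccati.IsPeriodicSolution (Riccati.familyField η) (2 * Real.pi) φ) ∧
      -- at `ηs` there is exactly one periodic solution, and it is double
      (∃ φ, Riccati.IsPeriodicSolution (Riccati.familyField ηs) (2 * Real.pi) φ ∧
        Riccati.IsDouble (Riccati.familyField ηs) (2 * Real.pi) φ ∧
        ∀ ψ, Riccati.IsPeriodicSolution (Riccati.familyField ηs) (2 * Real.pi) ψ → ψ = φ) ∧
      -- above `ηs` there are exactly two periodic solutions, and they are hyperbolic
      (∀ η : ℝ, ηs < η →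
        ∃ φ₁ φ₂, φ₁ ≠ φ₂ ∧
          Riccati.IsPeriodicSolution (Riccati.familyField η) (2 * Real.pi) φ₁ ∧
          Riccati.IsPeriodicSolution (Riccati.familyField η) (2 * Real.pi) φ₂ ∧
          Riccati.IsHyperbolic (Riccati.familyField η) (2 * Real.pi) φ₁ ∧
          Riccati.IsHyperbolic (Riccati.familyField η) (2 * Real.pi) φ₂ ∧
          ∀ ψ, Riccati.IsPeriodicSolution (Riccati.familyField η) (2 * Real.pi) ψ →
            ψ = φ₁ ∨ ψ = φ₂) := by
  open Riccati in
  refine ⟨fun η => gammaStar_isGreatest_isLeast Real.two_pi_pos (continuous_familyGamma η)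
    (periodic_familyGamma η), ?_⟩
  have hmono := strictMono_familyDiscriminant
  obtain ⟨ηs, hmem, h0⟩ := intermediate_value_Ioo (by linarith [Real.sqrt_nonneg 3])
    continuous_familyDiscriminant.continuousOn ⟨familyDiscriminant_neg, familyDiscriminant_one_pos⟩
  have hneg : ∀ η < ηs, familyDiscriminant η < 0 := fun η h => h0 ▸ hmono h
  have hpos : ∀ η, ηs < η → 0 < familyDiscriminant η := fun η h => h0 ▸ hmono h
  simp only [familyField_eq_riccatiField]
  exact ⟨ηs, hmem, fun η => ⟨fun h => hmono.injective (h.trans h0.symm), fun h => h ▸ h0⟩,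
    hneg, hpos,
    fun η h ⟨_, hφ⟩ => (hneg η h).not_ge
      ((periodicCoefficients_family η).discriminant_nonneg Real.two_pi_pos hφ),
    (periodicCoefficients_family ηs).exists_unique_isDouble Real.two_pi_pos h0,
    fun η h => (periodicCoefficients_family η).exists_two_isHyperbolic Real.two_pi_pos (hpos η h)⟩
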